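/- Let $M$ be a smooth manifold of dimension $n$ with a smooth pseudo-Riemannian metric $g$ of arbitrary signature and Levi-Civita connection $\nabla$. Let $(X_a)$ be a local pseudo-orthonormal frame on an open set $U\subseteq M$, with dual coframe $(e^a)$; indices are raised and lowered with $g$, repeated indices are summed, and $\nabla_a e^b=0=\nabla_a X_b$ (indices are tensor indices). Inhomogeneous differential forms carry the wedge product, the inner derivative $X_a\lrcorner$, the degree operator $\pi$ ($\pi\omega=p\,\omega$ for a $p$-form), $d=e^a\wedge\nabla_a$, $\delta=-X^a\lrcorner\nabla_a$, and the Clifford product determined by $\alpha\,\omega=\alpha\wedge\omega+\alpha^\sharp\lrcorner\,\omega$ for 1-forms $\alpha$ (so $e^ae^b+e^be^a=2g^{ab}$), with Clifford commutator $[\alpha,\beta]=\alpha\beta-\beta\alpha$; $*$ is the Hodge dual, and round brackets on indices denote symmetrization. A form $\omega$ is closed conformal Killing--Yano (CCKY) if $d\omega=0$ and $\nabla_a\omega-\frac1{\pi+1}X_a\lrcorner d\omega+\frac1{n-\pi+1}e_a\wedge\delta\omega=0$. For a form $\kappa$ put $\kappa^a=X^a\lrcorner\kappa$, $\tilde\kappa=\frac{\pi-1}{2\pi}d\kappa$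 (the coefficients of the operator $K_\kappa=\kappa^a\nabla_a+\tilde\kappa$), and for a form $\omega$ put $\omega^a=e^a\wedge\omega$, $\tilde\omega=-\frac{n-\pi-1}{2(n-\pi)}\delta\omega$ (the coefficients of $M_\omega=\omega^a\nabla_a+\tilde\omega$). For two such collections of coefficients set, with Clifford products, $$\{\kappa,\lambda\}^b=\kappa^a(\nabla_a\lambda^b)-\lambda^a(\nabla_a\kappa^b)+[\kappa^b,\tilde\lambda]-[\lambda^b,\tilde\kappa],$$ the first-order coefficient of the commutator of the two operators. The Killing--Yano brackets are $$[\kappa,\lambda]_{KY}=\tfrac1\pi\,e_b\wedge\{\kappa,\lambda\}^b,\qquad [\mu,\omega]_{KY}=\tfrac1{n-\pi}\,X_b\lrcorner\{\mu,\omega\}^b,\qquad [\alpha,\beta]_{KY}=\tfrac1\pi\,e_b\wedge\{\alpha,\beta\}^b,$$ where $\kappa,\lambda,\mu$ enter through the coefficients of $K$ and $\omega,\alpha,\beta$ through those of $M$; these are the solutions of $\{\kappa,\lambda\}^b=X^b\lrcorner[\kappa,\lambda]_{KY}$, $\{\mu,\omega\}^b=e^b\wedge[\mu,\omega]_{KY}$,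 $\{\alpha,\beta\}^b=X^b\lrcorner[\alpha,\beta]_{KY}$ whenever these equations are solvable. Let $h$ be a smooth, possibly degenerate, CCKY 2-form on $M$, and for $k\ge 0$ let $h^{(k)}=h\wedge\dots\wedge h$ ($k$ factors, $h^{(0)}=1$) and $f^{(k)}=*h^{(k)}$. Then for all $k,l\ge 0$: 1. $[e_{(a}\wedge h^{(k)},\,e_{b)}\wedge h^{(l)}]=0$ for all $a,b$, and $[h^{(k)},h^{(l)}]_{KY}=0$; 2. $[X_{(a}\lrcorner f^{(k)},\,X_{b)}\lrcorner f^{(l)}]=0$ for all $a,b$, and $[f^{(k)},f^{(l)}]_{KY}=0$; 3. if $n$ is odd, $[X_{(a}\lrcorner f^{(k)},\,e_{b)}\wedge h^{(l)}]=0$ for all $a,b$, and $[f^{(k)},h^{(l)}]_{KY}=0$. Moreover, in each of these three cases the bracket vanishes together with the whole first-order coefficient that it represents: $\{h^{(k)},h^{(l)}\}^b=0$, $\{f^{(k)},f^{(l)}\}^b=0$ and, if $n$ is odd, $\{f^{(k)},h^{(l)}\}^b=0$, for all $b$. -/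

import Mathlib

open scoped Manifold ContDiff

noncomputable section

namespace KillingYano

/-! ### Algebra of inhomogeneous forms in a pseudo-orthonormal frame

`Form n` is the exterior algebra on the coframe `e⁰, …, eⁿ⁻¹`; its product is the wedge product.
The inverse metric is `g^{ab} = η a δ^{ab}` with `η a = ± 1`. -/

/-- Inhomogeneous antisymmetric forms at a point, in terms of a coframe. -/
abbrev Form (n : ℕ) : Type := ExteriorAlgebra ℝ (Fin n → ℝ)

variable {n : ℕ}

/-- The 1-form `e^a`. -/
def coframe (a : Fin n) : Form n := ExteriorAlgebra.ι ℝ (Pi.single a 1)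

/-- `e^a ∧ α`. -/
def wedgeUp (a : Fin n) : Form n →ₗ[ℝ] Form n := LinearMap.mulLeft ℝ (coframe a)

/-- `e_a ∧ α`, where `e_a = g_{ab} e^b`. -/
def wedgeDown (η : Fin n → ℝ) (a : Fin n) : Form n →ₗ[ℝ] Form n := η a • wedgeUp a

/-- The inner derivative `X_a ⌟ α`. -/
def hookDown (a : Fin n) : Form n →ₗ[ℝ] Form n :=
  CliffordAlgebra.contractLeft (LinearMap.proj a : (Fin n → ℝ) →ₗ[ℝ] ℝ)

/-- `X^a ⌟ α`, where `X^a = g^{ab} X_b`. -/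
def hookUp (η : Fin n → ℝ) (a : Fin n) : Form n →ₗ[ℝ] Form n := η a • hookDown a

/-- The homogeneous part of degree `p`. -/
def part (p : ℕ) : Form n →ₗ[ℝ] Form n :=
  GradedAlgebra.proj (fun i : ℕ => ⋀[ℝ]^i (Fin n → ℝ)) p

/-- The function `c(π)` of the degree operator `π`: it multiplies the `p`-form part by `c p`. -/
def degMap (c : ℕ → ℝ) : Form n →ₗ[ℝ] Form n := ∑ p ∈ Finset.range (n + 1), c p • part p

/-- The quadratic form `v ↦ ∑ a, η a * v a ^ 2` of the inverse metric on covectors. -/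
def quad (η : Fin n → ℝ) : QuadraticForm ℝ (Fin n → ℝ) := QuadraticMap.weightedSumSquares ℝ η

/-- The Clifford product of forms, `e^a e^b + e^b e^a = 2 g^{ab}`, transported to the exterior
algebra by the canonical linear isomorphism. -/
def cmul (η : Fin n → ℝ) (α β : Form n) : Form n :=
  CliffordAlgebra.equivExterior (quad η)
    ((CliffordAlgebra.equivExterior (quad η)).symm α *
      (CliffordAlgebra.equivExterior (quad η)).symm β)

/-- The Clifford commutator. -/
def comm (η : Fin n → ℝ) (α β : Form n) : Form n := cmul η α β - cmul η β α

/-- The contracted wedge product. -/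
def cwedge (η : Fin n → ℝ) : ℕ → Form n → Form n → Form n
  | 0, α, β => α * β
  | k + 1, α, β => ∑ a, cwedge η k (hookDown a α) (hookUp η a β)

/-- The Levi-Civita form `e⁰ ∧ ⋯ ∧ eⁿ⁻¹`. -/
def levi : Form n := (List.ofFn fun a : Fin n => coframe a).prod

/-- The Hodge dual: on `p`-forms it is `(1 / p!) α ∧_p ε`, with the `p`-fold contracted wedge. -/
def hodge (η : Fin n → ℝ) (α : Form n) : Form n :=
  ∑ p ∈ Finset.range (n + 1), (1 / (p.factorial : ℝ)) • cwedge η p (part p α) levi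

/-! ### Metric, 2-forms, frames -/

section Geometry

variable (n)
variable (M : Type*) [TopologicalSpace M] [ChartedSpace (EuclideanSpace ℝ (Fin n)) M]
  [IsManifold (𝓡 n) ∞ M]

/-- A smooth pseudo-Riemannian metric, of any signature. -/
structure PseudoRiemannianMetric where
  toFun : ∀ x : M, TangentSpace (𝓡 n) x →L[ℝ] TangentSpace (𝓡 n) x →L[ℝ] ℝ
  symm : ∀ (x : M) (v w : TangentSpace (𝓡 n) x), toFun x v w = toFun x w v
  nondegenerate : ∀ (x : M) (v : TangentSpace (𝓡 n) x), (∀ w, toFun x v w = 0) → v = 0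
  contMDiff : ContMDiff (𝓡 n)
    ((𝓡 n).prod 𝓘(ℝ, EuclideanSpace ℝ (Fin n) →L[ℝ] EuclideanSpace ℝ (Fin n) →L[ℝ] ℝ)) ∞
    (fun x => Bundle.TotalSpace.mk'
      (EuclideanSpace ℝ (Fin n) →L[ℝ] EuclideanSpace ℝ (Fin n) →L[ℝ] ℝ) x (toFun x))

/-- A smooth differential 2-form. -/
structure TwoForm where
  toFun : ∀ x : M, TangentSpace (𝓡 n) x →L[ℝ] TangentSpace (𝓡 n) x →L[ℝ] ℝ
  alternating : ∀ (x : M) (v : TangentSpace (𝓡 n) x), toFun x v v = 0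
  contMDiff : ContMDiff (𝓡 n)
    ((𝓡 n).prod 𝓘(ℝ, EuclideanSpace ℝ (Fin n) →L[ℝ] EuclideanSpace ℝ (Fin n) →L[ℝ] ℝ)) ∞
    (fun x => Bundle.TotalSpace.mk'
      (EuclideanSpace ℝ (Fin n) →L[ℝ] EuclideanSpace ℝ (Fin n) →L[ℝ] ℝ) x (toFun x))

variable {n} {M}

/-- A smooth pseudo-orthonormal vector frame `X_a` on the open set `U`,
`g(X_a, X_b) = η a δ_{ab}` with `η a = ± 1`. -/
structure OrthonormalFrame (g : PseudoRiemannianMetric n M) (U : Set M) where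
  isOpen : IsOpen U
  vec : Fin n → ∀ x : M, TangentSpace (𝓡 n) x
  η : Fin n → ℝ
  η_eq : ∀ a, η a = 1 ∨ η a = -1
  contMDiffOn : ∀ a, ContMDiffOn (𝓡 n) (𝓡 n).tangent ∞
    (fun x => (⟨x, vec a x⟩ : TangentBundle (𝓡 n) M)) U
  inner_eq : ∀ x ∈ U, ∀ a b, g.toFun x (vec a x) (vec b x) = if a = b then η a else 0

/-- The derivative of a function along a vector field. -/
def lieFun (V : ∀ x : M, TangentSpace (𝓡 n) x) (f : M → ℝ) (x : M) : ℝ :=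
  mfderiv (𝓡 n) 𝓘(ℝ, ℝ) f x (V x)

/-- `g(∇_X Y, Z)` for the Levi-Civita connection, by the Koszul formula. -/
def koszul (g : PseudoRiemannianMetric n M) (X Y Z : ∀ x : M, TangentSpace (𝓡 n) x) (x : M) : ℝ :=
  (1 / 2) * (lieFun X (fun y => g.toFun y (Y y) (Z y)) x
    + lieFun Y (fun y => g.toFun y (X y) (Z y)) x
    - lieFun Z (fun y => g.toFun y (X y) (Y y)) x
    + g.toFun x (VectorField.mlieBracket (𝓡 n) X Y x) (Z x)
    - g.toFun x (VectorField.mlieBracket (𝓡 n) X Z x) (Y x)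
    - g.toFun x (VectorField.mlieBracket (𝓡 n) Y Z x) (X x))

namespace OrthonormalFrame

variable {g : PseudoRiemannianMetric n M} {U : Set M} (F : OrthonormalFrame g U)

/-- The components of a 2-form in the frame, `h = (1/2) h_{ab} e^a ∧ e^b`. -/
def ofTwoForm (h : TwoForm n M) (x : M) : Form n :=
  (1 / 2 : ℝ) • ∑ a, ∑ b, h.toFun x (F.vec a x) (F.vec b x) • (coframe a * coframe b)

/-- The connection coefficients `ω_{abc} = g(X_b, ∇_{X_a} X_c)`. -/
def connCoeff (x : M) (a b c : Fin n) : ℝ := koszul g (F.vec a) (F.vec c) (F.vec b) x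

/-- The connection 2-forms `ω_a = (1/2) ω_{abc} e^b ∧ e^c`. -/
def connForm (a : Fin n) (x : M) : Form n :=
  (1 / 2 : ℝ) • ∑ b, ∑ c, F.connCoeff x a b c • (coframe b * coframe c)

/-- `X_a[α]`: the components of `α` in the coframe are differentiated along `X_a`. -/
def deriv (a : Fin n) (α : M → Form n) (x : M) : Form n :=
  ∑ s : Finset (Fin n),
    lieFun (F.vec a) (fun y => (Pi.basisFun ℝ (Fin n)).ExteriorAlgebra.repr (α y) s) x •
      (Pi.basisFun ℝ (Fin n)).ExteriorAlgebra s

/-- The covariant derivative `∇_a α = X_a[α] - ω_a ∧_1 α` of a form. -/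
def nabla (a : Fin n) (α : M → Form n) (x : M) : Form n :=
  F.deriv a α x - cwedge F.η 1 (F.connForm a x) (α x)

/-- The exterior derivative `d = e^a ∧ ∇_a`. -/
def extd (α : M → Form n) (x : M) : Form n := ∑ a, wedgeUp a (F.nabla a α x)

/-- The co-differential `δ = - X^a ⌟ ∇_a`. -/
def codiff (α : M → Form n) (x : M) : Form n := -∑ a, hookUp F.η a (F.nabla a α x)

/-- The twistor operator
`T_a α = ∇_a α - (1 / (π + 1)) X_a ⌟ dα + (1 / (n - π + 1)) e_a ∧ δα`. -/
def twistor (a : Fin n) (α : M → Form n) (x : M) : Form n :=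
  F.nabla a α x - degMap (fun p => 1 / ((p : ℝ) + 1)) (hookDown a (F.extd α x))
    + degMap (fun p => 1 / ((n : ℝ) - p + 1)) (wedgeDown F.η a (F.codiff α x))

/-- Closed conformal Killing-Yano (CCKY) forms on the domain of the frame. -/
def IsCCKY (α : M → Form n) : Prop :=
  ∀ x ∈ U, (∀ a, F.twistor a α x = 0) ∧ F.extd α x = 0

/-- The zeroth-order term `((π - 1) / (2 π)) dκ` of the operator
`K_κ = X^a ⌟ κ ∇_a + ((π - 1) / (2 π)) dκ`. -/
def zeroK (κ : M → Form n) (x : M) : Form n :=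
  degMap (fun p => ((p : ℝ) - 1) / (2 * p)) (F.extd κ x)

/-- The zeroth-order term `- ((n - π - 1) / (2 (n - π))) δβ` of the operator
`M_β = e^a ∧ β ∇_a - ((n - π - 1) / (2 (n - π))) δβ`. -/
def zeroM (β : M → Form n) (x : M) : Form n :=
  -degMap (fun p => ((n : ℝ) - p - 1) / (2 * ((n : ℝ) - p))) (F.codiff β x)

/-- Let `P = P^a(α) ∇_a + α'` and `Q = Q^a(β) ∇_a + β'` be two first-order operators, where each
of `P^a`, `Q^a` is one of the (covariantly constant) maps `X^a ⌟` and `e^a ∧`, so that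
`∇_a (Q^b(β)) = Q^b(∇_a β)`. This is the coefficient of `∇_b` in the commutator `[P, Q]`:
`P^a(α) ∇_a(Q^b(β)) - Q^a(β) ∇_a(P^b(α)) + [P^b(α), β'] - [Q^b(β), α']`, with Clifford products. -/
def commCoeff (P : Fin n → Form n →ₗ[ℝ] Form n) (α α' : M → Form n)
    (Q : Fin n → Form n →ₗ[ℝ] Form n) (β β' : M → Form n) (b : Fin n) (x : M) : Form n :=
  (∑ a, (cmul F.η (P a (α x)) (Q b (F.nabla a β x))
      - cmul F.η (Q a (β x)) (P b (F.nabla a α x))))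
    + comm F.η (P b (α x)) (β' x) - comm F.η (Q b (β x)) (α' x)

/-- First-order coefficient of `[K_κ, K_κ']`. -/
def coeffKK (κ κ' : M → Form n) (b : Fin n) (x : M) : Form n :=
  F.commCoeff (hookUp F.η) κ (F.zeroK κ) (hookUp F.η) κ' (F.zeroK κ') b x

/-- First-order coefficient of `[K_κ, M_β]`. -/
def coeffKM (κ β : M → Form n) (b : Fin n) (x : M) : Form n :=
  F.commCoeff (hookUp F.η) κ (F.zeroK κ) wedgeUp β (F.zeroM β) b x

/-- First-order coefficient of `[M_α, M_β]`. -/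
def coeffMM (α β : M → Form n) (b : Fin n) (x : M) : Form n :=
  F.commCoeff wedgeUp α (F.zeroM α) wedgeUp β (F.zeroM β) b x

/-- The Killing-Yano bracket of two KY forms, `(1 / π) e_b ∧ {…}^b`, obtained by solving
`{…}^b = X^b ⌟ [κ, κ']_KY`, where `{…}^b` is the first-order coefficient of `[K_κ, K_κ']`. -/
def bracketKK (κ κ' : M → Form n) (x : M) : Form n :=
  degMap (fun p => 1 / (p : ℝ)) (∑ b, wedgeDown F.η b (F.coeffKK κ κ' b x))

/-- The Killing-Yano bracket of a KY form and a CCKY form, `(1 / (n - π)) X_b ⌟ {…}^b`, obtained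
by solving `{…}^b = e^b ∧ [κ, β]_KY`, where `{…}^b` is the first-order coefficient of
`[K_κ, M_β]`. -/
def bracketKM (κ β : M → Form n) (x : M) : Form n :=
  degMap (fun p => 1 / ((n : ℝ) - p)) (∑ b, hookDown b (F.coeffKM κ β b x))

/-- The Killing-Yano bracket of two CCKY forms, `(1 / π) e_b ∧ {…}^b`, obtained by solving
`{…}^b = X^b ⌟ [α, β]_KY`, where `{…}^b` is the first-order coefficient of `[M_α, M_β]`. -/
def bracketMM (α β : M → Form n) (x : M) : Form n :=
  degMap (fun p => 1 / (p : ℝ)) (∑ b, wedgeDown F.η b (F.coeffMM α β b x))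

/-- The tower `h^{(k)} = h ∧ ⋯ ∧ h` (`k` factors). -/
def towerH (h : TwoForm n M) (k : ℕ) (x : M) : Form n := F.ofTwoForm h x ^ k

/-- The dual tower `f^{(k)} = * h^{(k)}`. -/
def towerF (h : TwoForm n M) (k : ℕ) (x : M) : Form n := hodge F.η (F.towerH h k x)

end OrthonormalFrame

/-- A 2-form is closed conformal Killing-Yano if it is so in every local pseudo-orthonormal
frame. -/
def TwoForm.IsCCKY (h : TwoForm n M) (g : PseudoRiemannianMetric n M) : Prop :=
  ∀ (U : Set M) (F : OrthonormalFrame g U), F.IsCCKY (F.ofTwoForm h)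

end Geometry

end KillingYano

end

/-!
The whole statement is a computation in the Clifford algebra of one cotangent space. In a frame, a
closed conformal Killing-Yano 2-form satisfies `∇_a h = e_a ∧ ξ` for some 1-form `ξ`
(`exists_nabla_eq_of_isCCKY`), so with `g_k = h ^ k / k!` one gets `∇_a g_k = e_a ∧ ξ ∧ g_{k-1}`,
and the zeroth-order term of `M_{g_k}` is `(n - 2k) / 2 • ξ ∧ g_{k-1}` (for `2k > n` the power
vanishes). What remains is an identity between the elements `g_k` and the vectors of the Clifford
algebra.

The only facts about the `g_k` that enter are collected in the structure `CliffordTower`: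
`v g_k - g_k v = u g_{k-1} + g_{k-1} u` with `u = A v = v^♯ ⌟ h`, the commutativity of the `g_k`
(`cliffPow_mul_comm`) and the Euler relation `∑ e^a ∧ (X_a ⌟ g_k) = 2k g_k`. Commutativity is proved
by induction on `k + l`: by the inductive hypothesis `[g_k, g_l]` is an even element commuting with
every vector, hence a scalar, and a commutator in a finite-dimensional algebra has trace zero.

Let `W_k v = v g_k + g_k v`, which is `2 v ∧ g_k`. The symmetrization in `u, v` of the commutators
`[W_k u, W_l v]` changes sign under `(k, l) ↦ (k + 1, l - 1)`, so it is carried to negative indices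
and vanishes; this is `Om_symmetrized`. The vanishing of the first-order coefficient is
`sum_W_mul_ι_C_sub`. There the contraction over the frame is expressed by the operator
`N x = ∑ η_a e_a x e_a`, and one has to know `N` on `Ω_{k,l-1} - Ω_{k-1,l}`, where
`Ω_{k,l}(v, ξ) = [W_k v, W_l ξ]`. This is obtained in three stages, for `g_k g_l`, for
`W_k v g_l + g_l W_k v` and for `Ω_{k,l}`. The relations `Rr_eq` and `Om_recurrence` express the sum
of the terms with indices `(k, l)` and `(k - 1, l - 1)` through the preceding stage, so the formula
propagates along the diagonals, starting from negative indices (`diagonal_induction`).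

The Hodge dual of `h ^ k` is, up to sign, the Clifford product of `h ^ k` with the volume form
(`hodge_pow`). Right multiplication by the volume form is parallel and turns `e^a ∧` into `X^a ⌟`,
and the volume form commutes or anticommutes with all odd elements, according to the parity of `n`.
Hence the expressions for two dual towers are, up to sign, those for `h ^ k` and `h ^ l` multiplied
twice by the volume form. For odd `n` the volume form is central, so in the mixed case they are
those for `h ^ k` and `h ^ l` multiplied once by it.
-/

noncomputable section

/-! ### Commutation relations in a Clifford tower -/

/-- A Clifford algebra `R` over a space `V` of covectors with a frame `e` normalized by the signs
`η`, together with elements `g k` that satisfy the relations of the divided wedge powers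
`h ^ k / k!` of a 2-form `h`, where `A v` is the contraction of `h` with the metric dual of `v`. The
index `k` is an integer, with `g k = 0` for negative `k`, so that the relations hold without
exceptions. -/
structure CliffordTower (n : ℕ) (R V : Type*) [Ring R] [Algebra ℝ R] [AddCommGroup V]
    [Module ℝ V] where
  ι : V →ₗ[ℝ] R
  B : V → V → ℝ
  e : Fin n → V
  η : Fin n → ℝ
  A : V →ₗ[ℝ] V
  g : ℤ → R
  ι_mul_ι_add_swap : ∀ u v, ι u * ι v + ι v * ι u = algebraMap ℝ R (2 * B u v)
  sum_frame : ∀ v, ∑ a, (η a * B (e a) v) • e a = v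
  sum_frame_mul_self : ∑ a, η a • (ι (e a) * ι (e a)) = (n : ℝ) • 1
  g_of_neg : ∀ k, k < 0 → g k = 0
  ι_mul_g_sub : ∀ k v, ι v * g k - g k * ι v = ι (A v) * g (k - 1) + g (k - 1) * ι (A v)
  g_mul_g : ∀ k l, g k * g l = g l * g k
  euler : ∀ k, ∑ a, η a • (ι (e a) * (ι (e a) * g k - g k * ι (e a))) = (4 * k : ℝ) • g k

namespace CliffordTower

variable {n : ℕ} {R V : Type*} [Ring R] [Algebra ℝ R] [AddCommGroup V] [Module ℝ V]
  (T : CliffordTower n R V)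

/-- The anticommutator of `v` and `g k`, which is `2 v ∧ g k`. -/
def W (k : ℤ) : V →ₗ[ℝ] R :=
  LinearMap.mulRight ℝ (T.g k) ∘ₗ T.ι + LinearMap.mulLeft ℝ (T.g k) ∘ₗ T.ι

theorem W_apply (k : ℤ) (v : V) : T.W k v = T.ι v * T.g k + T.g k * T.ι v := rfl

theorem ι_mul_g (k : ℤ) (v : V) : T.ι v * T.g k - T.g k * T.ι v = T.W (k - 1) (T.A v) :=
  T.ι_mul_g_sub k v

/-- The anticommutator of `W k v` and `g l`. -/
def Rr (k l : ℤ) (v : V) : R := T.W k v * T.g l + T.g l * T.W k v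

/-- The commutator of `W k v` and `W l ξ`. -/
def Om (k l : ℤ) (v ξ : V) : R := T.W k v * T.W l ξ - T.W l ξ * T.W k v

/-- Both sides expand to products of `v` with `g k` and `g l`, and agree since `g k` and `g l`
commute. -/
theorem Rr_symm (k l : ℤ) (v : V) : T.Rr k l v = T.Rr l k v := by
  have h := T.g_mul_g k l
  simp only [Rr, W_apply]
  linear_combination (norm := noncomm_ring) T.ι v * h - h * T.ι v

theorem W_mul_g (k l : ℤ) (v : V) :
    T.W k v * T.g l - T.g l * T.W k v = T.Rr k (l - 1) (T.A v) := by
  have h := T.g_mul_g k l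
  have h1 := T.ι_mul_g l v
  rw [T.Rr_symm]
  simp only [Rr]
  rw [← h1]
  simp only [W_apply]
  linear_combination (norm := noncomm_ring) T.ι v * h + h * T.ι v

theorem ι_mul_ι_comm (u v : V) (x : R) :
    (T.ι u * T.ι v + T.ι v * T.ι u) * x = x * (T.ι u * T.ι v + T.ι v * T.ι u) := by
  rw [T.ι_mul_ι_add_swap, Algebra.commutes]

theorem W_ι_symm (k : ℤ) (u v : V) :
    (T.W k u * T.ι v - T.ι v * T.W k u) + (T.W k v * T.ι u - T.ι u * T.W k v) = 0 := by
  have h := T.ι_mul_ι_comm u v (T.g k)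
  simp only [W_apply]
  linear_combination (norm := noncomm_ring) -h

theorem Om_swap (k l : ℤ) (u v : V) : T.Om l k v u = - T.Om k l u v := by
  simp only [Om]; noncomm_ring

theorem Om_eq (k l : ℤ) (v ξ : V) :
    T.Om k l v ξ = (T.ι v * T.W l ξ - T.W l ξ * T.ι v) * T.g k
        + T.g k * (T.ι v * T.W l ξ - T.W l ξ * T.ι v)
      - (T.ι v * T.Rr l (k - 1) (T.A ξ) + T.Rr l (k - 1) (T.A ξ) * T.ι v) := by
  rw [← T.W_mul_g]
  simp only [Om, T.W_apply k]
  noncomm_ring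

/-- The part of `Om k l u v` symmetric in `u` and `v` changes sign when the indices are shifted
along the antidiagonal, because `Rr` is symmetric in its indices and the commutator of `W k u` with
`v` is antisymmetric in `u` and `v`. -/
theorem Om_symmetrized_shift (k l : ℤ) (u v : V) :
    T.Om k l u v + T.Om k l v u = - (T.Om (k + 1) (l - 1) u v + T.Om (k + 1) (l - 1) v u) := by
  have h1 := T.Om_eq l k v u
  have h2 := T.Om_eq l k u v
  have h3 := T.Om_eq (k + 1) (l - 1) v u
  have h4 := T.Om_eq (k + 1) (l - 1) u v
  have h5 := T.W_ι_symm k u v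
  have h6 := T.W_ι_symm (l - 1) u v
  rw [T.Om_swap] at h1 h2
  rw [add_sub_cancel_right, T.Rr_symm] at h3 h4
  linear_combination (norm := noncomm_ring) h3 + h4 - h1 - h2 + h5 * T.g l + T.g l * h5
    - h6 * T.g (k + 1) - T.g (k + 1) * h6

theorem W_of_neg {k : ℤ} (hk : k < 0) (v : V) : T.W k v = 0 := by
  simp [W_apply, T.g_of_neg k hk]

/-- The symmetrized Clifford commutator of `u ∧ g k` and `v ∧ g l` vanishes. -/
theorem Om_symmetrized (k l : ℤ) (u v : V) : T.Om k l u v + T.Om k l v u = 0 := by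
  have key : ∀ (m : ℕ) (k l : ℤ), l < m → T.Om k l u v + T.Om k l v u = 0 := by
    intro m
    induction m with
    | zero => intro k l hl; simp [Om, T.W_of_neg (by simpa using hl)]
    | succ m ih =>
      intro k l hl
      rw [T.Om_symmetrized_shift, ih (k + 1) (l - 1) (by push_cast at hl; omega), neg_zero]
  exact key (l.toNat + 1) k l (by push_cast; omega)

theorem Om_self (k l : ℤ) (v : V) : T.Om k l v v = 0 := by
  have h := T.Om_symmetrized k l v v
  rw [← two_smul ℝ] at h
  simpa using h

theorem Om_symm (k l : ℤ) (v ξ : V) : T.Om k l v ξ = T.Om l k v ξ := by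
  rw [T.Om_swap l k, eq_comm, ← sub_eq_zero, ← T.Om_symmetrized l k v ξ]
  abel

/-- The commutator of `v` and `W (l - 1) ξ`, which is `4 v ∧ ξ ∧ g (l - 1)`. -/
def C (l : ℤ) (v ξ : V) : R := T.ι v * T.W (l - 1) ξ - T.W (l - 1) ξ * T.ι v

theorem g_mul_C (k l : ℤ) (v ξ : V) :
    2 * (T.g k * T.C l v ξ - T.g l * T.C k v ξ)
      = T.Om k (l - 1) v ξ - T.Om (k - 1) l v ξ := by
  have h1 := T.Om_eq k (l - 1) v ξ
  have h2 := T.Om_eq l (k - 1) v ξ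
  have h3 := T.Rr_symm (l - 1) (k - 1) (T.A ξ)
  have h4 := T.Om_symm (k - 1) (l - 1) (T.A v) ξ
  have h5 := T.W_mul_g (l - 1) k ξ
  have h6 := T.W_mul_g (k - 1) l ξ
  simp only [Om, ← T.ι_mul_g] at h4
  rw [T.Om_symm (k - 1) l]
  simp only [C]
  linear_combination (norm := noncomm_ring) h2 - h1 + 2 * h3 * T.ι v - h4
    + h5 * T.ι v - T.ι v * h5 - h6 * T.ι v + T.ι v * h6

/-- Expresses `Rr` along a diagonal through the products `g k * g l`. -/
theorem Rr_eq (k l : ℤ) (v : V) :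
    T.Rr k l v + T.Rr (k - 1) (l - 1) (T.A (T.A v))
      = 2 * (T.ι v * (T.g k * T.g l) + T.g k * T.g l * T.ι v) := by
  have h1 := T.W_mul_g (k - 1) l (T.A v)
  have h := T.g_mul_g k l
  rw [← T.ι_mul_g] at h1
  rw [← h1]
  simp only [Rr, W_apply]
  linear_combination (norm := noncomm_ring) -2 * h * T.ι v

theorem ι_mul_W (l : ℤ) (v ξ : V) :
    T.ι v * T.W l ξ + T.W l ξ * T.ι v
      = 2 * ((T.ι v * T.ι ξ + T.ι ξ * T.ι v) * T.g l) + T.C l (T.A v) ξ := by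
  have h1 := T.W_ι_symm (l - 1) (T.A v) ξ
  have h2 := T.ι_mul_g l v
  have h3 := T.ι_mul_ι_comm v ξ (T.g l)
  simp only [C, W_apply T l]
  linear_combination (norm := noncomm_ring) h2 * T.ι ξ - T.ι ξ * h2 + h1 - h3

/-- Expresses `Om` along a diagonal through `Rr`. -/
theorem Om_recurrence (k l : ℤ) (v ξ : V) :
    T.Om k l v ξ + T.Om (k - 1) (l - 1) (T.A (T.A v)) ξ
      = (T.ι v * T.Rr k l ξ - T.Rr k l ξ * T.ι v)
        - (T.ι (T.A v) * T.Rr (k - 1) (l - 1) (T.A ξ)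
          - T.Rr (k - 1) (l - 1) (T.A ξ) * T.ι (T.A v)) := by
  have h1 := T.ι_mul_W l v ξ
  have h2 := T.W_mul_g (l - 1) k ξ
  have h3 := T.g_mul_g k l
  have h4 := T.ι_mul_ι_comm v ξ (T.g k)
  have h5 := T.ι_mul_g k (T.A v)
  rw [T.Rr_symm (k - 1), T.Rr_symm k, ← h2]
  simp only [Om, ← h5, Rr, T.W_apply k]
  simp only [C] at h1
  linear_combination (norm := noncomm_ring) T.g k * h1 - h1 * T.g k
    - 2 * (h4 * T.g l) + 2 * ((T.ι v * T.ι ξ + T.ι ξ * T.ι v) * h3)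

/-! ### Contraction over the frame -/

/-- The contraction `x ↦ ∑ a, η a e_a x e_a` over the frame; on a `p`-form it is multiplication by
`(-1) ^ p (n - 2 p)`. -/
def N : R →ₗ[ℝ] R := ∑ a, T.η a • LinearMap.mulLeft ℝ (T.ι (T.e a)) ∘ₗ
  LinearMap.mulRight ℝ (T.ι (T.e a))

theorem N_apply (x : R) : T.N x = ∑ a, T.η a • (T.ι (T.e a) * x * T.ι (T.e a)) := by
  simp [N, mul_assoc]

theorem sum_frame_ι (v : V) : ∑ a, T.η a • (algebraMap ℝ R (2 * T.B (T.e a) v) * T.ι (T.e a))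
    = 2 * T.ι v := by
  nth_rewrite 2 [← T.sum_frame v]
  rw [map_sum, Finset.mul_sum]
  refine Finset.sum_congr rfl fun a _ => ?_
  rw [map_smul, ← Algebra.smul_def, mul_smul, two_smul, two_mul, mul_smul]
  simp only [smul_add]

theorem N_ι_mul (v : V) (x : R) : T.N (T.ι v * x) = 2 * (x * T.ι v) - T.ι v * T.N x := by
  have h := congrArg (x * ·) (T.sum_frame_ι v)
  simp only [Finset.mul_sum, mul_smul_comm] at h
  rw [eq_sub_iff_add_eq, N_apply, N_apply, Finset.mul_sum, ← Finset.sum_add_distrib]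
  trans x * (2 * T.ι v)
  · rw [← h]
    refine Finset.sum_congr rfl fun a _ => ?_
    have hc := T.ι_mul_ι_comm (T.e a) v x
    rw [← T.ι_mul_ι_add_swap, mul_smul_comm, ← smul_add]
    congr 1
    linear_combination (norm := noncomm_ring) hc * T.ι (T.e a)
  · noncomm_ring

theorem N_mul_ι (v : V) (x : R) : T.N (x * T.ι v) = 2 * (T.ι v * x) - T.N x * T.ι v := by
  have h := congrArg (· * x) (T.sum_frame_ι v)
  simp only [Finset.sum_mul, smul_mul_assoc] at h
  rw [eq_sub_iff_add_eq, N_apply, N_apply, Finset.sum_mul, ← Finset.sum_add_distrib]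
  trans (2 * T.ι v) * x
  · rw [← h]
    refine Finset.sum_congr rfl fun a _ => ?_
    have hc := T.ι_mul_ι_comm (T.e a) v (T.ι (T.e a))
    have hx := T.ι_mul_ι_comm (T.e a) v (T.ι (T.e a) * x)
    rw [← T.ι_mul_ι_add_swap, smul_mul_assoc, ← smul_add]
    congr 1
    linear_combination (norm := noncomm_ring) - hx
  · noncomm_ring

theorem sum_ι_mul_W (k : ℤ) :
    ∑ a, T.η a • (T.ι (T.e a) * T.W k (T.A (T.e a))) = (4 * (k + 1) : ℝ) • T.g (k + 1) := by
  have h := T.euler (k + 1)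
  simp only [T.ι_mul_g, add_sub_cancel_right] at h
  rw [h]; push_cast; rfl

theorem N_g (k : ℤ) : T.N (T.g k) = (n - 4 * k : ℝ) • T.g k := by
  have h := T.euler k
  have h2 := congrArg (· * T.g k) T.sum_frame_mul_self
  simp only [Finset.sum_mul, smul_mul_assoc, one_mul] at h2
  rw [sub_smul, ← h, ← h2, N_apply, ← Finset.sum_sub_distrib]
  refine Finset.sum_congr rfl fun a _ => ?_
  rw [← smul_sub]
  congr 1
  noncomm_ring

theorem sum_W_mul_ι (k : ℤ) :
    ∑ a, T.η a • (T.W k (T.A (T.e a)) * T.ι (T.e a)) = -((4 * (k + 1) : ℝ) • T.g (k + 1)) := by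
  have h2 := congrArg (T.g (k + 1) * ·) T.sum_frame_mul_self
  simp only [Finset.mul_sum, mul_smul_comm, mul_one] at h2
  have h3 := T.N_g (k + 1)
  rw [N_apply, sub_smul, ← h2] at h3
  push_cast at h3
  trans ∑ a, T.η a • (T.ι (T.e a) * T.g (k + 1) * T.ι (T.e a))
    - ∑ a, T.η a • (T.g (k + 1) * (T.ι (T.e a) * T.ι (T.e a)))
  · rw [← Finset.sum_sub_distrib]
    refine Finset.sum_congr rfl fun a _ => ?_
    have h4 := T.ι_mul_g (k + 1) (T.e a)
    rw [add_sub_cancel_right] at h4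
    rw [← smul_sub, ← h4]
    congr 1
    noncomm_ring
  · rw [h3]; abel

/-- The contraction of `W k (A e_a)` with `W l (A e_a)` over the frame. -/
def H (k l : ℤ) : R := ∑ a, T.η a • (T.W k (T.A (T.e a)) * T.W l (T.A (T.e a)))

theorem H_symm (k l : ℤ) : T.H k l = T.H l k := by
  rw [← sub_eq_zero, H, H, ← Finset.sum_sub_distrib]
  refine Finset.sum_eq_zero fun a _ => ?_
  rw [← smul_sub]
  exact smul_eq_zero_of_right _ (T.Om_self _ _ _)

theorem N_g_mul_g (k l : ℤ) : (n : ℝ) • (T.g k * T.g l) - T.N (T.g k * T.g l)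
    = (4 * (k + l) : ℝ) • (T.g k * T.g l) + T.H (k - 1) (l - 1) := by
  have h0 := congrArg (· * (T.g k * T.g l)) T.sum_frame_mul_self
  have h1 := congrArg (· * T.g l) (T.sum_ι_mul_W (k - 1))
  have h2 := congrArg (T.g k * ·) (T.sum_ι_mul_W (l - 1))
  simp only [Finset.sum_mul, Finset.mul_sum, smul_mul_assoc, mul_smul_comm, one_mul,
    sub_add_cancel] at h0 h1 h2
  push_cast at h1 h2
  rw [sub_add_cancel] at h1 h2
  rw [mul_add, add_smul, ← h0, ← h1, ← h2, N_apply, H, ← Finset.sum_sub_distrib,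
    ← Finset.sum_add_distrib, ← Finset.sum_add_distrib]
  refine Finset.sum_congr rfl fun a _ => ?_
  rw [← smul_sub, ← smul_add, ← smul_add]
  congr 1
  simp only [← T.ι_mul_g]
  noncomm_ring

theorem two_H (k l : ℤ) : (2 : ℝ) • T.H k (l - 1)
    = -∑ a, T.η a • (T.ι (T.e a) * T.Rr k (l - 1) (T.A (T.A (T.e a)))
      + T.Rr k (l - 1) (T.A (T.A (T.e a))) * T.ι (T.e a)) := by
  have h1 := congrArg₂ (· + ·) (T.sum_ι_mul_W k) (T.sum_W_mul_ι k)
  simp only [add_neg_cancel, ← Finset.sum_add_distrib, ← smul_add] at h1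
  have h2 := congrArg (fun x => x * T.g l - T.g l * x) h1
  simp only [Finset.sum_mul, Finset.mul_sum, smul_mul_assoc, mul_smul_comm, zero_mul, mul_zero,
    ← Finset.sum_sub_distrib, ← smul_sub, sub_zero] at h2
  rw [two_smul]
  nth_rewrite 2 [H_symm]
  rw [H, H, ← Finset.sum_add_distrib, eq_neg_iff_add_eq_zero, ← Finset.sum_add_distrib, ← h2]
  refine Finset.sum_congr rfl fun a _ => ?_
  rw [← smul_add, ← smul_add]
  congr 1
  rw [← T.ι_mul_g, ← T.W_mul_g]
  noncomm_ring

theorem H_sub (k l : ℤ) : T.H k (l - 1) - T.H (k - 1) l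
    = (8 * (l + 1) : ℝ) • (T.g k * T.g (l + 1)) - (8 * (k + 1) : ℝ) • (T.g (k + 1) * T.g l) := by
  have hW (k l : ℤ) : ∑ a, T.η a • ((T.ι (T.e a) * T.W l (T.A (T.e a))
      - T.W l (T.A (T.e a)) * T.ι (T.e a)) * T.g k
      + T.g k * (T.ι (T.e a) * T.W l (T.A (T.e a)) - T.W l (T.A (T.e a)) * T.ι (T.e a)))
      = (16 * (l + 1) : ℝ) • (T.g k * T.g (l + 1)) := by
    have h1 := congrArg₂ (· - ·) (T.sum_ι_mul_W l) (T.sum_W_mul_ι l)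
    have h2 := congrArg (fun x => x * T.g k + T.g k * x) h1
    simp only [← Finset.sum_sub_distrib, ← smul_sub, Finset.sum_mul, Finset.mul_sum,
      smul_mul_assoc, mul_smul_comm, ← Finset.sum_add_distrib, ← smul_add] at h2
    rw [h2]
    simp only [sub_neg_eq_add, add_mul, mul_add, smul_mul_assoc, mul_smul_comm,
      T.g_mul_g (l + 1) k]
    module
  have h1 := hW k l
  have h2 := hW l k
  have h3 := T.two_H k l
  have h4 := T.two_H l k
  rw [T.H_symm l] at h4
  rw [T.g_mul_g (k + 1) l]
  apply smul_right_injective R (two_ne_zero (α := ℝ))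
  dsimp only
  rw [smul_sub, smul_sub, h3, h4, smul_smul, smul_smul]
  trans (16 * (l + 1) : ℝ) • (T.g k * T.g (l + 1)) - (16 * (k + 1) : ℝ) • (T.g l * T.g (k + 1))
  · rw [← h1, ← h2, neg_sub_neg, ← Finset.sum_sub_distrib, ← Finset.sum_sub_distrib]
    refine Finset.sum_congr rfl fun a _ => ?_
    rw [← smul_sub, ← smul_sub]
    congr 1
    have h5 := T.Om_eq k l (T.e a) (T.A (T.e a))
    have h6 := T.Om_eq l k (T.e a) (T.A (T.e a))
    rw [T.Om_symm] at h5
    linear_combination (norm := noncomm_ring) h5 - h6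
  · module

/-- The first stage: the sums over the frame in `N_g_mul_g` are eliminated by `H_sub`. -/
theorem N_g_mul_g_sub (k l : ℤ) :
    (n : ℝ) • (T.g k * T.g (l - 1) - T.g (k - 1) * T.g l)
        - T.N (T.g k * T.g (l - 1) - T.g (k - 1) * T.g l)
      = (4 * (l - 1 - k) : ℝ) • (T.g k * T.g (l - 1))
        + (4 * (l - k + 1) : ℝ) • (T.g (k - 1) * T.g l) := by
  have h1 := T.N_g_mul_g k (l - 1)
  have h2 := T.N_g_mul_g (k - 1) l
  have h3 := T.H_sub (k - 1) (l - 1)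
  push_cast at h1 h2 h3
  simp only [sub_add_cancel] at h3
  rw [map_sub]
  linear_combination (norm := module) h1 - h2 + h3

theorem Rr_eq_zero {k l : ℤ} (h : k < 0 ∨ l < 0) (v : V) : T.Rr k l v = 0 := by
  rcases h with h | h
  · simp [Rr, T.W_of_neg h]
  · simp [Rr, T.g_of_neg l h]

theorem Om_eq_zero {k l : ℤ} (h : k < 0 ∨ l < 0) (v ξ : V) : T.Om k l v ξ = 0 := by
  rcases h with h | h <;> simp [Om, T.W_of_neg h]

/-- A function of the indices that changes sign under `(k, l) ↦ (k - 1, l - 1)`, up to the action of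
`A`, and that vanishes for negative `k` is zero. -/
theorem diagonal_induction (F : ℤ → ℤ → V → R) (h0 : ∀ k l v, k < 0 → F k l v = 0)
    (h : ∀ k l v, F k l v + F (k - 1) (l - 1) (T.A (T.A v)) = 0) (k l : ℤ) (v : V) :
    F k l v = 0 := by
  have key : ∀ (m : ℕ) (k l : ℤ) (v : V), k < m → F k l v = 0 := by
    intro m
    induction m with
    | zero => intro k l v hk; exact h0 k l v (by simpa using hk)
    | succ m ih =>
      intro k l v hk
      have h1 := h k l v
      rwa [ih (k - 1) (l - 1) _ (by push_cast at hk; omega), add_zero] at h1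
  exact key (k.toNat + 1) k l v (by push_cast; omega)

/-- The second stage: the defect of this formula is, along diagonals, the anticommutator of `v` with
the defect of `N_g_mul_g_sub`. -/
theorem N_Rr_sub (k l : ℤ) (v : V) :
    (n - 2 : ℝ) • (T.Rr k (l - 1) v - T.Rr (k - 1) l v)
        + T.N (T.Rr k (l - 1) v - T.Rr (k - 1) l v)
      = (4 * (l - 1 - k) : ℝ) • T.Rr k (l - 1) v + (4 * (l - k + 1) : ℝ) • T.Rr (k - 1) l v := by
  rw [← sub_eq_zero]
  refine T.diagonal_induction (fun k l v => (n - 2 : ℝ) • (T.Rr k (l - 1) v - T.Rr (k - 1) l v)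
        + T.N (T.Rr k (l - 1) v - T.Rr (k - 1) l v)
      - ((4 * (l - 1 - k) : ℝ) • T.Rr k (l - 1) v + (4 * (l - k + 1) : ℝ) • T.Rr (k - 1) l v))
      ?_ ?_ k l v
  · intro k l v hk
    simp [T.Rr_eq_zero (.inl hk), T.Rr_eq_zero (.inl (by omega : k - 1 < 0))]
  · intro k l v
    have h1 := T.Rr_eq k (l - 1) v
    have h2 := T.Rr_eq (k - 1) l v
    have h3 := T.N_g_mul_g_sub k l
    have h4 := congrArg T.N h1
    have h5 := congrArg T.N h2
    have h6 := congrArg (fun x => T.ι v * x + x * T.ι v) h3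
    have e2 (x : R) : 2 * x = (2 : ℝ) • x := by rw [two_mul, two_smul]
    simp only [map_add, map_sub, e2, map_smul, N_ι_mul, N_mul_ι, mul_add, add_mul, mul_sub,
      sub_mul, smul_mul_assoc, mul_smul_comm, smul_sub, smul_add] at h1 h2 h3 h4 h5 h6 ⊢
    push_cast
    linear_combination (norm := module) (n - 2 - 4 * (l - 1 - k) : ℝ) • h1
      - (n - 2 + 4 * (l - k + 1) : ℝ) • h2 + h4 - h5 + (2 : ℝ) • h6

/-- The third stage: the defect of this formula is, along diagonals, the commutator of vectors with
the defect of `N_Rr_sub`. -/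
theorem N_Om_sub (k l : ℤ) (v ξ : V) :
    (n - 4 : ℝ) • (T.Om k (l - 1) v ξ - T.Om (k - 1) l v ξ)
        - T.N (T.Om k (l - 1) v ξ - T.Om (k - 1) l v ξ)
      = (4 * (l - 1 - k) : ℝ) • T.Om k (l - 1) v ξ
        + (4 * (l - k + 1) : ℝ) • T.Om (k - 1) l v ξ := by
  rw [← sub_eq_zero]
  refine T.diagonal_induction (fun k l v =>
      (n - 4 : ℝ) • (T.Om k (l - 1) v ξ - T.Om (k - 1) l v ξ)
        - T.N (T.Om k (l - 1) v ξ - T.Om (k - 1) l v ξ)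
      - ((4 * (l - 1 - k) : ℝ) • T.Om k (l - 1) v ξ
        + (4 * (l - k + 1) : ℝ) • T.Om (k - 1) l v ξ)) ?_ ?_ k l v
  · intro k l v hk
    simp [T.Om_eq_zero (.inl hk), T.Om_eq_zero (.inl (by omega : k - 1 < 0))]
  · intro k l v
    have h1 := T.Om_recurrence k (l - 1) v ξ
    have h2 := T.Om_recurrence (k - 1) l v ξ
    have h3 := T.N_Rr_sub k l ξ
    have h3' := T.N_Rr_sub (k - 1) (l - 1) (T.A ξ)
    have h4 := congrArg T.N h1
    have h5 := congrArg T.N h2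
    have h6 := congrArg (fun x => T.ι v * x - x * T.ι v) h3
    have h7 := congrArg (fun x => T.ι (T.A v) * x - x * T.ι (T.A v)) h3'
    have e2 (x : R) : 2 * x = (2 : ℝ) • x := by rw [two_mul, two_smul]
    simp only [map_add, map_sub, e2, N_ι_mul, N_mul_ι, mul_add, add_mul, mul_sub,
      sub_mul, smul_mul_assoc, mul_smul_comm, smul_sub] at h1 h2 h4 h5 h6 h7 ⊢
    push_cast at h7 ⊢
    linear_combination (norm := module) (n - 4 - 4 * (l - 1 - k) : ℝ) • h1
      - (n - 4 + 4 * (l - k + 1) : ℝ) • h2 - h4 + h5 + h6 - h7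

theorem N_C (l : ℤ) (v ξ : V) : T.N (T.C l v ξ) = (n - 4 * l : ℝ) • T.C l v ξ := by
  have e2 (x : R) : 2 * x = (2 : ℝ) • x := by rw [two_mul, two_smul]
  have h := T.N_g (l - 1)
  simp only [C, W_apply, map_add, map_sub, N_ι_mul, N_mul_ι, h, e2, mul_add, add_mul, mul_sub,
      sub_mul, smul_mul_assoc, mul_smul_comm, smul_sub, smul_add]
  push_cast
  module

/-- Expanding both anticommutators, three of the four sums are products of the contractions of `1`,
`g k` and `C l v ξ`, on which `N` is scalar; the fourth is `N` of the product. -/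
theorem sum_W_mul_ι_C (k l : ℤ) (v ξ : V) :
    ∑ a, T.η a • (T.W k (T.e a) * (T.ι (T.e a) * T.C l v ξ + T.C l v ξ * T.ι (T.e a)))
      = (3 * n - 4 * k - 4 * l : ℝ) • (T.g k * T.C l v ξ) + T.N (T.g k * T.C l v ξ) := by
  have h0 := congrArg (fun x => T.g k * x * T.C l v ξ) T.sum_frame_mul_self
  have h1 := congrArg (· * T.C l v ξ) (T.N_g k)
  have h2 := congrArg (T.g k * ·) (T.N_C l v ξ)
  have h3 := T.N_apply (T.g k * T.C l v ξ)
  simp only [N_apply, Finset.sum_mul, Finset.mul_sum, smul_mul_assoc, mul_smul_comm,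
    mul_one] at h0 h1 h2
  trans (n : ℝ) • (T.g k * T.C l v ξ) + (n - 4 * k : ℝ) • (T.g k * T.C l v ξ)
    + (n - 4 * l : ℝ) • (T.g k * T.C l v ξ) + T.N (T.g k * T.C l v ξ)
  · rw [← h0, ← h1, ← h2, h3]
    simp only [← Finset.sum_add_distrib]
    refine Finset.sum_congr rfl fun a _ => ?_
    simp only [← smul_add]
    congr 1
    rw [W_apply]
    noncomm_ring
  · module

/-- The identity behind the vanishing of the first-order coefficients. In terms of forms the
left-hand side contracts `e_a ∧ g k` with `e_a ∧ v ∧ ξ ∧ g (l - 1)`, antisymmetrized in `k` and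
`l`. -/
theorem sum_W_mul_ι_C_sub (k l : ℤ) (v ξ : V) :
    ∑ a, T.η a • (T.W k (T.e a) * (T.ι (T.e a) * T.C l v ξ + T.C l v ξ * T.ι (T.e a)))
      - ∑ a, T.η a • (T.W l (T.e a) * (T.ι (T.e a) * T.C k v ξ + T.C k v ξ * T.ι (T.e a)))
      = (2 * (n - 2 * l) : ℝ) • T.Om k (l - 1) v ξ
        - (2 * (n - 2 * k) : ℝ) • T.Om l (k - 1) v ξ := by
  have h1 := T.g_mul_C k l v ξ
  have h2 := congrArg T.N h1
  have h3 := T.N_Om_sub k l v ξ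
  have e2 (x : R) : 2 * x = (2 : ℝ) • x := by rw [two_mul, two_smul]
  rw [sum_W_mul_ι_C, sum_W_mul_ι_C, T.Om_symm l]
  apply smul_right_injective R (two_ne_zero (α := ℝ))
  dsimp only
  simp only [e2, map_smul, map_sub, smul_sub] at h1 h2 h3 ⊢
  linear_combination (norm := module) (3 * n - 4 * k - 4 * l : ℝ) • h1 + h2 - h3

end CliffordTower

namespace KillingYano

variable {n : ℕ}

/-! ### Degrees and contractions of forms -/

/-- The contraction of a form with a linear functional on covectors. -/
abbrev hook (d : Module.Dual ℝ (Fin n → ℝ)) : Form n →ₗ[ℝ] Form n :=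
  CliffordAlgebra.contractLeft d

/-- A covector as a form of degree one. -/
abbrev vec : (Fin n → ℝ) →ₗ[ℝ] Form n := ExteriorAlgebra.ι ℝ

theorem hook_vec_mul (d : Module.Dual ℝ (Fin n → ℝ)) (v : Fin n → ℝ) (x : Form n) :
    hook d (vec v * x) = d v • x - vec v * hook d x :=
  CliffordAlgebra.contractLeft_ι_mul d v x

theorem hook_algebraMap (d : Module.Dual ℝ (Fin n → ℝ)) (r : ℝ) :
    hook d (algebraMap ℝ (Form n) r) = 0 :=
  CliffordAlgebra.contractLeft_algebraMap 0 d r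

theorem vec_mul_vec_mul (u v : Fin n → ℝ) (x : Form n) :
    vec u * (vec v * x) = -(vec v * (vec u * x)) := by
  have h := ExteriorAlgebra.ι_add_mul_swap (R := ℝ) u v
  rw [← mul_assoc, ← mul_assoc, ← neg_mul, eq_neg_of_add_eq_zero_left h]

theorem hook_hook (d d' : Module.Dual ℝ (Fin n → ℝ)) (x : Form n) :
    hook d (hook d' x) = -hook d' (hook d x) :=
  CliffordAlgebra.contractLeft_comm d d' x

theorem exteriorPower_succ_induction {p : ℕ} {P : Form n → Prop} {x : Form n}
    (hx : x ∈ ⋀[ℝ]^(p + 1) (Fin n → ℝ))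
    (hmul : ∀ v : Fin n → ℝ, ∀ y ∈ ⋀[ℝ]^p (Fin n → ℝ), P (vec v * y))
    (hadd : ∀ x y, P x → P y → P (x + y)) :
    P x := by
  rw [ExteriorAlgebra.exteriorPower, pow_succ'] at hx
  refine Submodule.mul_induction_on hx ?_ hadd
  rintro _ ⟨v, rfl⟩ y hy
  exact hmul v y hy

theorem exists_algebraMap_of_mem_zero {x : Form n} (hx : x ∈ ⋀[ℝ]^0 (Fin n → ℝ)) :
    ∃ r : ℝ, x = algebraMap ℝ _ r := by
  rw [ExteriorAlgebra.exteriorPower, pow_zero, Submodule.mem_one] at hx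
  obtain ⟨r, rfl⟩ := hx
  exact ⟨r, rfl⟩

theorem vec_mul_mem {p : ℕ} (v : Fin n → ℝ) {x : Form n} (hx : x ∈ ⋀[ℝ]^p (Fin n → ℝ)) :
    vec v * x ∈ ⋀[ℝ]^(p + 1) (Fin n → ℝ) := by
  rw [ExteriorAlgebra.exteriorPower, pow_succ']
  exact Submodule.mul_mem_mul ⟨v, rfl⟩ hx

theorem hook_mem_zero (d : Module.Dual ℝ (Fin n → ℝ)) {x : Form n}
    (hx : x ∈ ⋀[ℝ]^0 (Fin n → ℝ)) : hook d x = 0 := by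
  obtain ⟨r, rfl⟩ := exists_algebraMap_of_mem_zero hx
  exact hook_algebraMap d r

theorem hook_mem {p : ℕ} (d : Module.Dual ℝ (Fin n → ℝ)) {x : Form n}
    (hx : x ∈ ⋀[ℝ]^p (Fin n → ℝ)) :
    hook d x ∈ ⋀[ℝ]^(p - 1) (Fin n → ℝ) := by
  induction p generalizing x with
  | zero => rw [hook_mem_zero d hx]; exact Submodule.zero_mem _
  | succ p ih =>
    refine exteriorPower_succ_induction (P := fun x => hook d x ∈ ⋀[ℝ]^(p + 1 - 1) (Fin n → ℝ)) hx
      (fun v y hy => ?_) (fun x y hx hy => ?_)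
    · rw [hook_vec_mul]
      refine Submodule.sub_mem _ (Submodule.smul_mem _ _ hy) ?_
      cases p with
      | zero => rw [hook_mem_zero d hy, mul_zero]; exact Submodule.zero_mem _
      | succ p => exact vec_mul_mem v (ih hy)
    · rw [map_add]; exact Submodule.add_mem _ hx hy

theorem involute_of_mem {p : ℕ} {x : Form n} (hx : x ∈ ⋀[ℝ]^p (Fin n → ℝ)) :
    CliffordAlgebra.involute x = (-1 : ℝ) ^ p • x := by
  induction p generalizing x with
  | zero => obtain ⟨r, rfl⟩ := exists_algebraMap_of_mem_zero hx; simp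
  | succ p ih =>
    refine exteriorPower_succ_induction
      (P := fun x => CliffordAlgebra.involute x = (-1 : ℝ) ^ (p + 1) • x) hx
      (fun v y hy => ?_) (fun x y hx hy => ?_)
    · rw [map_mul, ih hy, CliffordAlgebra.involute_ι, mul_smul_comm, neg_mul, pow_succ]
      simp
    · rw [map_add, hx, hy, smul_add]

theorem exteriorPower_eq_zero {p : ℕ} (hp : n < p) {x : Form n}
    (hx : x ∈ ⋀[ℝ]^p (Fin n → ℝ)) : x = 0 := by
  have h := exteriorPower.finrank_eq (R := ℝ) (M := Fin n → ℝ) (n := p)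
  rw [Module.finrank_fin_fun, Nat.choose_eq_zero_of_lt hp, Module.finrank_zero_iff] at h
  exact congrArg Subtype.val (Subsingleton.elim (⟨x, hx⟩ : ⋀[ℝ]^p (Fin n → ℝ)) 0)

theorem part_of_mem {p : ℕ} {x : Form n}
    (hx : x ∈ ⋀[ℝ]^p (Fin n → ℝ)) (q : ℕ) : part q x = if p = q then x else 0 := by
  rw [part, GradedAlgebra.proj_apply]
  split_ifs with h
  · subst h; exact DirectSum.decompose_of_mem_same _ hx
  · exact DirectSum.decompose_of_mem_ne _ hx h

theorem degMap_of_mem {p : ℕ} (c : ℕ → ℝ) {x : Form n}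
    (hx : x ∈ ⋀[ℝ]^p (Fin n → ℝ)) : degMap c x = c p • x := by
  simp only [degMap, LinearMap.sum_apply, LinearMap.smul_apply, part_of_mem hx, smul_ite,
    smul_zero, Finset.sum_ite_eq, Finset.mem_range]
  split_ifs with h
  · rfl
  · rw [exteriorPower_eq_zero (by omega) hx, smul_zero]

theorem sum_coframe (v : Fin n → ℝ) : ∑ a, v a • (coframe a : Form n) = vec v := by
  simp only [coframe, ← map_smul, ← map_sum]
  congr 1
  ext b
  simp [Finset.sum_apply, Pi.single_apply]

/-- Euler's relation `e^a ∧ (X_a ⌟ x) = p x` for a `p`-form. -/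
theorem sum_coframe_mul_hookDown {p : ℕ} {x : Form n} (hx : x ∈ ⋀[ℝ]^p (Fin n → ℝ)) :
    ∑ a, coframe a * hookDown a x = (p : ℝ) • x := by
  induction p generalizing x with
  | zero =>
    simp only [hookDown, hook_mem_zero _ hx, mul_zero, Finset.sum_const_zero]
    simp
  | succ p ih =>
    refine exteriorPower_succ_induction
      (P := fun x => ∑ a, coframe a * hookDown a x = ((p + 1 : ℕ) : ℝ) • x) hx
      (fun v y hy => ?_) (fun x y hx hy => ?_)
    · have h1 (a : Fin n) : coframe a * hookDown a (vec v * y)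
          = (v a • coframe a) * y + vec v * (coframe a * hookDown a y) := by
        rw [hookDown, hook_vec_mul, mul_sub, coframe, vec_mul_vec_mul v]
        simp [hook, vec, sub_eq_add_neg]
      simp only [h1, Finset.sum_add_distrib, ← Finset.sum_mul, ← Finset.mul_sum, sum_coframe,
        ih hy]
      push_cast
      rw [mul_smul_comm, add_smul, one_smul, add_comm]
    · simp only [map_add, mul_add, Finset.sum_add_distrib, hx, hy, smul_add]

theorem sum_hookDown_coframe_mul {p : ℕ} {x : Form n} (hx : x ∈ ⋀[ℝ]^p (Fin n → ℝ)) :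
    ∑ a, hookDown a (coframe a * x) = (n - p : ℝ) • x := by
  have h1 (a : Fin n) : hookDown a (coframe a * x) = x - coframe a * hookDown a x := by
    rw [hookDown, coframe]
    erw [hook_vec_mul]
    simp
  simp only [h1, Finset.sum_sub_distrib, sum_coframe_mul_hookDown hx, sub_smul]
  simp [← Nat.cast_smul_eq_nsmul ℝ]

/-- A form all of whose contractions vanish is a scalar, by Euler's relation in each degree. -/
theorem exists_algebraMap_of_hookDown_eq_zero {x : Form n} (hx : ∀ a, hookDown a x = 0) :
    ∃ r : ℝ, x = algebraMap ℝ _ r := by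
  have h0 : ∀ p, part p x ∈ ⋀[ℝ]^p (Fin n → ℝ) := fun p => SetLike.coe_mem _
  have h1 : x = ∑ p ∈ Finset.range (n + 1), part p x := by
    classical
    conv_lhs => rw [← DirectSum.sum_support_decompose (fun i : ℕ => ⋀[ℝ]^i (Fin n → ℝ)) x]
    refine Finset.sum_subset_zero_on_sdiff (fun p hp => ?_) (fun p hp => ?_) (fun p _ => rfl)
    · by_contra h
      rw [Finset.mem_range, not_lt, Nat.succ_le_iff] at h
      exact (DFinsupp.mem_support_iff.1 hp) (Subtype.ext (exteriorPower_eq_zero h (h0 p)))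
    · have := (Finset.mem_sdiff.1 hp).2
      rw [DFinsupp.mem_support_iff, not_not] at this
      exact congrArg Subtype.val this
  have h2 : ∑ p ∈ Finset.range (n + 1), (p : ℝ) • part p x = 0 := by
    have : ∑ a, coframe a * hookDown a x = 0 := by simp [hx]
    rw [h1] at this
    simp only [map_sum, Finset.mul_sum] at this
    rw [Finset.sum_comm] at this
    rw [← this]
    exact Finset.sum_congr rfl fun p _ => (sum_coframe_mul_hookDown (h0 p)).symm
  have h3 : ∀ p ∈ Finset.range (n + 1), p ≠ 0 → part p x = 0 := by
    intro p hp hp0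
    have := congrArg (part p) h2
    simp only [map_sum, map_smul, map_zero, part_of_mem (h0 _)] at this
    simp only [smul_ite, smul_zero, Finset.sum_ite_eq', hp, if_true] at this
    simpa [hp0] using this
  rw [Finset.sum_eq_single 0 h3 (by simp)] at h1
  rw [h1]
  exact exists_algebraMap_of_mem_zero (h0 0)

/-! ### Forms and the Clifford algebra -/

/-- The linear functional `u ↦ ∑ a, η a * v a * u a`: the metric dual of the covector `v`. -/
def dual (η : Fin n → ℝ) (v : Fin n → ℝ) : Module.Dual ℝ (Fin n → ℝ) :=
  QuadraticMap.associated (quad η) v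

theorem dual_apply (η v u : Fin n → ℝ) : dual η v u = ∑ a, η a * v a * u a := by
  have h : (2 : ℝ) * dual η v u = QuadraticMap.polar (quad η) v u := by
    rw [dual, ← smul_eq_mul, ofNat_smul_eq_nsmul]
    exact congrArg (fun f => f v u) (QuadraticMap.two_nsmul_associated ℝ (quad η))
  apply mul_left_cancel₀ (two_ne_zero (α := ℝ))
  rw [h, QuadraticMap.polar]
  simp only [quad, QuadraticMap.weightedSumSquares_apply, Pi.add_apply, smul_eq_mul]
  rw [← Finset.sum_sub_distrib, ← Finset.sum_sub_distrib, Finset.mul_sum]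
  exact Finset.sum_congr rfl fun a _ => by ring

theorem dual_comm (η u v : Fin n → ℝ) : dual η u v = dual η v u := by
  simp only [dual_apply]
  exact Finset.sum_congr rfl fun a _ => by ring

theorem hookUp_eq (η : Fin n → ℝ) (a : Fin n) :
    hookUp η a = hook (dual η (Pi.single a 1)) := by
  have h : dual η (Pi.single a 1) = η a • LinearMap.proj a := by
    ext b
    simp only [dual_apply, Pi.single_apply, LinearMap.comp_apply, LinearMap.single_apply, mul_ite,
      mul_one, mul_zero, Finset.sum_ite_eq', Finset.mem_univ, if_true, LinearMap.smul_apply,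
      LinearMap.proj_apply, smul_eq_mul]
    split_ifs <;> simp_all
  rw [hookUp, h, hook, map_smul]; rfl

/-- The Clifford algebra of the inverse metric, `e^a e^b + e^b e^a = 2 g^{ab}`. -/
abbrev Cl (η : Fin n → ℝ) : Type := CliffordAlgebra (quad η)

/-- The canonical linear isomorphism from the Clifford algebra to forms. -/
abbrev toForm (η : Fin n → ℝ) : Cl η ≃ₗ[ℝ] Form n := CliffordAlgebra.equivExterior (quad η)

/-- A covector as an element of the Clifford algebra. -/
abbrev gam (η : Fin n → ℝ) : (Fin n → ℝ) →ₗ[ℝ] Cl η := CliffordAlgebra.ι (quad η)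

theorem toForm_algebraMap (η : Fin n → ℝ) (r : ℝ) :
    toForm η (algebraMap ℝ _ r) = algebraMap ℝ _ r :=
  CliffordAlgebra.changeForm_algebraMap CliffordAlgebra.changeForm.associated_neg_proof r

theorem toForm_gam (η : Fin n → ℝ) (v : Fin n → ℝ) : toForm η (gam η v) = vec v :=
  CliffordAlgebra.changeForm_ι CliffordAlgebra.changeForm.associated_neg_proof v

theorem toForm_gam_mul (η : Fin n → ℝ) (v : Fin n → ℝ) (x : Cl η) :
    toForm η (gam η v * x) = vec v * toForm η x + hook (dual η v) (toForm η x) := by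
  refine (CliffordAlgebra.changeForm_ι_mul
    CliffordAlgebra.changeForm.associated_neg_proof v x).trans ?_
  have h : QuadraticMap.associated (-quad η) v = -dual η v := by
    rw [map_neg]; rfl
  have h' (y : Form n) : hook (-dual η v) y = -hook (dual η v) y := by
    rw [hook, map_neg]; rfl
  rw [h, ← sub_neg_eq_add, ← h']
  rfl

theorem involute_hook (d : Module.Dual ℝ (Fin n → ℝ)) (x : Form n) :
    CliffordAlgebra.involute (hook d x) = -hook d (CliffordAlgebra.involute x) := by
  induction x using CliffordAlgebra.left_induction with
  | algebraMap r => simp [hook]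
  | add x y hx hy => simp only [map_add, hx, hy, neg_add]
  | ι_mul x v hx =>
    have h2 : CliffordAlgebra.involute (vec v) = -vec v := CliffordAlgebra.involute_ι _
    change CliffordAlgebra.involute (hook d (vec v * x))
      = -hook d (CliffordAlgebra.involute (vec v * x))
    simp only [hook_vec_mul, map_sub, map_mul, hx, h2, map_smul, neg_mul, map_neg, mul_neg]
    abel

/-- Clifford multiplication by a covector from the right. The involution is the sign `(-1) ^ p` on
`p`-forms. -/
theorem toForm_mul_gam (η : Fin n → ℝ) (v : Fin n → ℝ) (x : Cl η) :
    toForm η (x * gam η v) = vec v * CliffordAlgebra.involute (toForm η x)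
      - hook (dual η v) (CliffordAlgebra.involute (toForm η x)) := by
  induction x using CliffordAlgebra.left_induction with
  | algebraMap r =>
    rw [toForm_algebraMap, AlgHom.commutes, hook_algebraMap, sub_zero, ← Algebra.commutes,
      ← Algebra.smul_def, ← Algebra.smul_def, map_smul, toForm_gam]
  | add x y hx hy =>
    simp only [map_add, mul_add, add_mul, hx, hy]
    abel
  | ι_mul x u hx =>
    rw [mul_assoc, toForm_gam_mul, hx, toForm_gam_mul]
    have h1 := dual_comm η u v
    have h2 : CliffordAlgebra.involute (vec u) = -vec u := CliffordAlgebra.involute_ι _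
    simp only [map_add, map_sub, map_mul, map_neg, involute_hook, hook_vec_mul, h1, h2, mul_sub,
      mul_add, neg_mul, mul_neg]
    rw [vec_mul_vec_mul u v, hook_hook (dual η u)]
    abel

/-- Contraction is an antiderivation. -/
theorem hook_mul (d : Module.Dual ℝ (Fin n → ℝ)) (x y : Form n) :
    hook d (x * y) = hook d x * y + CliffordAlgebra.involute x * hook d y := by
  induction x using CliffordAlgebra.left_induction with
  | algebraMap r =>
    rw [hook_algebraMap, ← Algebra.smul_def, map_smul, AlgHom.commutes, ← Algebra.smul_def]
    simp
  | add x x' hx hx' => simp only [map_add, add_mul, hx, hx']; abel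
  | ι_mul x v hx =>
    have h2 : CliffordAlgebra.involute (vec v) = -vec v := CliffordAlgebra.involute_ι _
    change hook d (vec v * x * y) = hook d (vec v * x) * y
      + CliffordAlgebra.involute (vec v * x) * hook d y
    rw [mul_assoc, hook_vec_mul, hook_vec_mul, hx, map_mul, h2, sub_mul, mul_add]
    simp only [smul_mul_assoc, neg_mul, mul_assoc]
    abel

theorem mul_comm_of_mem_two {H : Form n} (hH : H ∈ ⋀[ℝ]^2 (Fin n → ℝ)) (x : Form n) :
    H * x = x * H := by
  have h1 (v : Fin n → ℝ) : H * vec v = vec v * H := by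
    refine exteriorPower_succ_induction (P := fun H => H * vec v = vec v * H) hH
      (fun u y hy => ?_) (fun x y hx hy => by rw [add_mul, mul_add, hx, hy])
    refine exteriorPower_succ_induction (P := fun y => vec u * y * vec v = vec v * (vec u * y)) hy
      (fun w z hz => ?_) (fun x y hx hy => by simp only [add_mul, mul_add, hx, hy])
    obtain ⟨r, rfl⟩ := exists_algebraMap_of_mem_zero hz
    rw [← Algebra.commutes, ← Algebra.smul_def]
    simp only [mul_smul_comm, smul_mul_assoc, mul_assoc]
    rw [vec_mul_vec_mul v u]
    have := ExteriorAlgebra.ι_add_mul_swap (R := ℝ) w v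
    rw [eq_neg_of_add_eq_zero_left this, mul_neg]
  induction x using CliffordAlgebra.left_induction with
  | algebraMap r => exact (Algebra.commutes r H).symm
  | add x y hx hy => rw [mul_add, add_mul, hx, hy]
  | ι_mul x v hx =>
    change H * (vec v * x) = vec v * x * H
    rw [← mul_assoc, h1, mul_assoc, hx, mul_assoc]

/-! ### Divided wedge powers of a 2-form -/

/-- The divided wedge powers `H ^ k / k!` of a form, zero for negative `k`. -/
def divPow (H : Form n) (k : ℤ) : Form n :=
  if k < 0 then 0 else ((k.toNat.factorial : ℝ)⁻¹) • H ^ k.toNat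

theorem divPow_of_neg (H : Form n) {k : ℤ} (hk : k < 0) : divPow H k = 0 := if_pos hk

theorem divPow_natCast (H : Form n) (k : ℕ) : divPow H k = ((k.factorial : ℝ)⁻¹) • H ^ k := by
  simp [divPow]

theorem divPow_mem {H : Form n} (hH : H ∈ ⋀[ℝ]^2 (Fin n → ℝ)) (k : ℕ) :
    divPow H k ∈ ⋀[ℝ]^(2 * k) (Fin n → ℝ) := by
  rw [divPow_natCast]
  refine Submodule.smul_mem _ _ ?_
  have h := SetLike.pow_mem_graded (A := fun i : ℕ => ⋀[ℝ]^i (Fin n → ℝ)) k hH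
  rwa [smul_eq_mul, mul_comm] at h

theorem involute_divPow {H : Form n} (hH : H ∈ ⋀[ℝ]^2 (Fin n → ℝ)) (k : ℤ) :
    CliffordAlgebra.involute (divPow H k) = divPow H k := by
  rcases lt_or_ge k 0 with hk | hk
  · rw [divPow_of_neg H hk, map_zero]
  · lift k to ℕ using hk
    rw [involute_of_mem (divPow_mem hH k), pow_mul]
    simp

theorem mul_divPow {H : Form n} (k : ℤ) : H * divPow H (k - 1) = (k : ℝ) • divPow H k := by
  rcases lt_trichotomy k 0 with hk | rfl | hk
  · rw [divPow_of_neg H hk, divPow_of_neg H (by omega)]; simp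
  · rw [divPow_of_neg H (by omega)]; simp
  · obtain ⟨m, rfl⟩ : ∃ m : ℕ, k = ((m + 1 : ℕ) : ℤ) := ⟨k.toNat - 1, by omega⟩
    rw [show ((m + 1 : ℕ) : ℤ) - 1 = (m : ℤ) by push_cast; ring, divPow_natCast, divPow_natCast,
      mul_smul_comm, ← pow_succ', smul_smul, Nat.factorial_succ]
    congr 1
    have := Nat.factorial_ne_zero m
    push_cast
    field_simp

/-- If `D` acts on powers of `H` as a derivation, it acts on the divided powers by
`D (H ^ k / k!) = D H * H ^ (k - 1) / (k - 1)!`. -/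
theorem map_divPow_of_derivation (D : Form n →ₗ[ℝ] Form n) {H : Form n}
    (hH : H ∈ ⋀[ℝ]^2 (Fin n → ℝ)) (h1 : D 1 = 0)
    (hmul : ∀ y, D (H * y) = D H * y + H * D y) (k : ℤ) :
    D (divPow H k) = D H * divPow H (k - 1) := by
  rcases lt_or_ge k 0 with hk | hk
  · rw [divPow_of_neg H hk, divPow_of_neg H (by omega), map_zero, mul_zero]
  · lift k to ℕ using hk
    induction k with
    | zero =>
      rw [divPow_of_neg H (k := ((0 : ℕ) : ℤ) - 1) (by simp), mul_zero, divPow_natCast]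
      simp [h1]
    | succ k ih =>
      have h2 := mul_divPow (H := H) ((k + 1 : ℕ) : ℤ)
      have h3 := mul_divPow (H := H) (k : ℤ)
      have hk : (((k + 1 : ℕ) : ℤ) : ℝ) ≠ 0 := by exact_mod_cast Nat.succ_ne_zero k
      rw [show ((k + 1 : ℕ) : ℤ) - 1 = (k : ℤ) by push_cast; ring] at h2 ⊢
      apply smul_right_injective _ hk
      dsimp only
      rw [← map_smul, ← h2, hmul, ih, ← mul_assoc, mul_comm_of_mem_two hH, mul_assoc, h3]
      push_cast
      rw [mul_smul_comm, add_smul, one_smul, add_comm]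

theorem hook_divPow (d : Module.Dual ℝ (Fin n → ℝ)) {H : Form n}
    (hH : H ∈ ⋀[ℝ]^2 (Fin n → ℝ)) (k : ℤ) :
    hook d (divPow H k) = hook d H * divPow H (k - 1) := by
  refine map_divPow_of_derivation (hook d) hH ?_ (fun y => ?_) k
  · exact CliffordAlgebra.contractLeft_one (Q := 0) (d := d)
  · rw [hook_mul, involute_of_mem hH]; simp

/-- The endomorphism `v ↦ v^♯ ⌟ H` of covectors defined by a 2-form `H`. -/
def endo (η : Fin n → ℝ) (H : Form n) : (Fin n → ℝ) →ₗ[ℝ] (Fin n → ℝ) :=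
  ExteriorAlgebra.ιInv ∘ₗ CliffordAlgebra.contractLeft.flip H ∘ₗ QuadraticMap.associated (quad η)

theorem vec_ιInv_of_mem_one {x : Form n} (hx : x ∈ ⋀[ℝ]^1 (Fin n → ℝ)) :
    vec (ExteriorAlgebra.ιInv x) = x := by
  rw [ExteriorAlgebra.exteriorPower, pow_one] at hx
  obtain ⟨v, rfl⟩ := hx
  rw [ExteriorAlgebra.ι_leftInverse v]

theorem vec_endo (η : Fin n → ℝ) {H : Form n} (hH : H ∈ ⋀[ℝ]^2 (Fin n → ℝ)) (v : Fin n → ℝ) :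
    vec (endo η H v) = hook (dual η v) H :=
  vec_ιInv_of_mem_one (hook_mem (dual η v) hH)

theorem toForm_involute (η : Fin n → ℝ) (x : Cl η) :
    toForm η (CliffordAlgebra.involute x) = CliffordAlgebra.involute (toForm η x) := by
  induction x using CliffordAlgebra.left_induction with
  | algebraMap r => rw [AlgHom.commutes, toForm_algebraMap, AlgHom.commutes]
  | add x y hx hy => simp only [map_add, hx, hy]
  | ι_mul x v hx =>
    have h2 : CliffordAlgebra.involute (vec v) = -vec v := CliffordAlgebra.involute_ι _
    rw [map_mul, CliffordAlgebra.involute_ι, neg_mul, map_neg, toForm_gam_mul, hx, toForm_gam_mul,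
      map_add, map_mul, h2, involute_hook]
    noncomm_ring

theorem toForm_comm_of_even (η : Fin n → ℝ) (v : Fin n → ℝ) {x : Cl η}
    (hx : CliffordAlgebra.involute (toForm η x) = toForm η x) :
    toForm η (gam η v * x - x * gam η v) = (2 : ℝ) • hook (dual η v) (toForm η x) := by
  rw [map_sub, toForm_gam_mul, toForm_mul_gam, hx]
  module

theorem toForm_anticomm_of_even (η : Fin n → ℝ) (v : Fin n → ℝ) {x : Cl η}
    (hx : CliffordAlgebra.involute (toForm η x) = toForm η x) :
    toForm η (gam η v * x + x * gam η v) = (2 : ℝ) • (vec v * toForm η x) := by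
  rw [map_add, toForm_gam_mul, toForm_mul_gam, hx]
  module

theorem toForm_comm_of_odd (η : Fin n → ℝ) (v : Fin n → ℝ) {x : Cl η}
    (hx : CliffordAlgebra.involute (toForm η x) = -toForm η x) :
    toForm η (gam η v * x - x * gam η v) = (2 : ℝ) • (vec v * toForm η x) := by
  rw [map_sub, toForm_gam_mul, toForm_mul_gam, hx, map_neg, mul_neg]
  module

/-- The Clifford element of `H ^ k / k!`. -/
def cliffPow (η : Fin n → ℝ) (H : Form n) (k : ℤ) : Cl η := (toForm η).symm (divPow H k)

theorem toForm_cliffPow (η : Fin n → ℝ) (H : Form n) (k : ℤ) :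
    toForm η (cliffPow η H k) = divPow H k := (toForm η).apply_symm_apply _

theorem gam_mul_cliffPow_sub (η : Fin n → ℝ) {H : Form n} (hH : H ∈ ⋀[ℝ]^2 (Fin n → ℝ)) (k : ℤ)
    (v : Fin n → ℝ) : gam η v * cliffPow η H k - cliffPow η H k * gam η v
      = gam η (endo η H v) * cliffPow η H (k - 1) + cliffPow η H (k - 1) * gam η (endo η H v) := by
  have h (k : ℤ) : CliffordAlgebra.involute (toForm η (cliffPow η H k))
      = toForm η (cliffPow η H k) := by
    rw [toForm_cliffPow, involute_divPow hH]
  apply (toForm η).injective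
  rw [toForm_comm_of_even η v (h k), toForm_anticomm_of_even η _ (h _), toForm_cliffPow,
    toForm_cliffPow, hook_divPow _ hH, vec_endo η hH]

theorem hookDown_eq {η : Fin n → ℝ} (hη : ∀ a, η a = 1 ∨ η a = -1) (a : Fin n) (x : Form n) :
    hookDown a x = η a • hook (dual η (Pi.single a 1)) x := by
  rw [← hookUp_eq, hookUp, LinearMap.smul_apply, smul_smul]
  rcases hη a with h | h <;> simp [h]

/-- An even element of the Clifford algebra that commutes with all vectors is a scalar. -/
theorem exists_algebraMap_of_even_of_central {η : Fin n → ℝ} (hη : ∀ a, η a = 1 ∨ η a = -1)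
    {x : Cl η} (hx : CliffordAlgebra.involute x = x) (hc : ∀ v, gam η v * x - x * gam η v = 0) :
    ∃ r : ℝ, x = algebraMap ℝ _ r := by
  have h (a : Fin n) : hookDown a (toForm η x) = 0 := by
    have h1 := toForm_comm_of_even η (Pi.single a 1) (x := x) (by rw [← toForm_involute, hx])
    rw [hc, map_zero, eq_comm, smul_eq_zero_iff_right two_ne_zero] at h1
    rw [hookDown_eq hη, h1, smul_zero]
  obtain ⟨r, hr⟩ := exists_algebraMap_of_hookDown_eq_zero h
  exact ⟨r, (toForm η).injective (by rw [hr, toForm_algebraMap])⟩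

/-- In a finite-dimensional algebra a commutator is not a nonzero scalar. -/
theorem eq_zero_of_comm_eq_algebraMap {R : Type*} [Ring R] [Algebra ℝ R] [Module.Finite ℝ R]
    [Nontrivial R] {x y : R} {r : ℝ} (h : x * y - y * x = algebraMap ℝ R r) : r = 0 := by
  have h1 := congrArg (fun z => LinearMap.trace ℝ R (LinearMap.mulLeft ℝ z)) h
  have h2 : LinearMap.mulLeft ℝ (x * y - y * x) = LinearMap.mulLeft ℝ x * LinearMap.mulLeft ℝ y
      - LinearMap.mulLeft ℝ y * LinearMap.mulLeft ℝ x := by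
    ext z; simp [sub_mul, mul_assoc]
  have h3 : LinearMap.mulLeft ℝ (algebraMap ℝ R r) = r • LinearMap.id := by
    ext z; simp [Algebra.smul_def]
  rw [h2, h3, map_sub, LinearMap.trace_mul_comm, sub_self, map_smul, LinearMap.trace_id,
    smul_eq_mul] at h1
  have := Module.finrank_pos (R := ℝ) (M := R)
  rcases mul_eq_zero.1 h1.symm with h4 | h4
  · exact h4
  · have : Module.finrank ℝ R = 0 := by exact_mod_cast h4
    omega

instance (η : Fin n → ℝ) : Module.Finite ℝ (Cl η) :=
  have : Module.Finite ℝ (Form n) := Module.Finite.of_basis (Pi.basisFun ℝ (Fin n)).ExteriorAlgebra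
  Module.Finite.equiv (toForm η).symm

/-- The wedge powers of a 2-form commute in the Clifford algebra. By induction on `k + l` their
commutator commutes with all vectors; being even, it is a scalar, and a scalar commutator is
zero. -/
theorem cliffPow_mul_comm {η : Fin n → ℝ} (hη : ∀ a, η a = 1 ∨ η a = -1) {H : Form n}
    (hH : H ∈ ⋀[ℝ]^2 (Fin n → ℝ)) (k l : ℤ) :
    cliffPow η H k * cliffPow η H l = cliffPow η H l * cliffPow η H k := by
  have h0 {k : ℤ} (hk : k < 0) : cliffPow η H k = 0 := by
    rw [cliffPow, divPow_of_neg H hk, map_zero]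
  have key : ∀ (m : ℕ) (k l : ℤ), k + l < m →
      cliffPow η H k * cliffPow η H l - cliffPow η H l * cliffPow η H k = 0 := by
    intro m
    induction m with
    | zero =>
      intro k l hkl
      rcases lt_or_ge k 0 with hk | hk
      · simp [h0 hk]
      · simp [h0 (show l < 0 by push_cast at hkl; omega)]
    | succ m ih =>
      intro k l hkl
      push_cast at hkl
      have h1 := ih (k - 1) l (by omega)
      have h2 := ih k (l - 1) (by omega)
      have h3 := ih (k - 1) (l - 1) (by omega)
      have hinv (k : ℤ) : CliffordAlgebra.involute (cliffPow η H k) = cliffPow η H k :=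
        (toForm η).injective (by
          rw [toForm_involute, toForm_cliffPow, involute_divPow hH])
      obtain ⟨r, hr⟩ := exists_algebraMap_of_even_of_central hη
        (x := cliffPow η H k * cliffPow η H l - cliffPow η H l * cliffPow η H k)
        (by rw [map_sub, map_mul, map_mul, hinv, hinv]) (fun v => by
          have e1 := gam_mul_cliffPow_sub η hH k v
          have e2 := gam_mul_cliffPow_sub η hH l v
          have e3 := gam_mul_cliffPow_sub η hH k (endo η H v)
          have e4 := gam_mul_cliffPow_sub η hH l (endo η H v)
          linear_combination (norm := noncomm_ring)
            e1 * cliffPow η H l + cliffPow η H k * e2 - e2 * cliffPow η H k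
            - cliffPow η H l * e1 + cliffPow η H (k - 1) * e4 + e4 * cliffPow η H (k - 1)
            - e3 * cliffPow η H (l - 1) - cliffPow η H (l - 1) * e3
            + gam η (endo η H v) * h1 + gam η (endo η H v) * h2
            + h1 * gam η (endo η H v) + h2 * gam η (endo η H v)
            + h3 * gam η (endo η H (endo η H v)) - gam η (endo η H (endo η H v)) * h3)
      rw [hr, eq_zero_of_comm_eq_algebraMap hr, map_zero]
  exact sub_eq_zero.1 (key ((k + l).toNat + 1) k l (by push_cast; omega))

theorem cliffPow_of_neg (η : Fin n → ℝ) (H : Form n) {k : ℤ} (hk : k < 0) :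
    cliffPow η H k = 0 := by
  rw [cliffPow, divPow_of_neg H hk, map_zero]

/-- The divided wedge powers of a 2-form as a Clifford tower. -/
def tower {η : Fin n → ℝ} (hη : ∀ a, η a = 1 ∨ η a = -1) {H : Form n}
    (hH : H ∈ ⋀[ℝ]^2 (Fin n → ℝ)) : CliffordTower n (Cl η) (Fin n → ℝ) where
  ι := gam η
  B u v := dual η u v
  e a := Pi.single a 1
  η := η
  A := endo η H
  g := cliffPow η H
  ι_mul_ι_add_swap u v := by
    rw [CliffordAlgebra.ι_mul_ι_add_swap]
    congr 1
    rw [dual, ← smul_eq_mul, ofNat_smul_eq_nsmul]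
    exact (congrArg (fun f => f u v) (QuadraticMap.two_nsmul_associated ℝ (quad η))).symm
  sum_frame v := by
    have h (a : Fin n) : η a * dual η (Pi.single a 1) v = v a := by
      rcases hη a with h | h <;> simp [dual_apply, Pi.single_apply, h]
    simp only [h]
    ext b
    simp [Finset.sum_apply, Pi.single_apply]
  sum_frame_mul_self := by
    have h (a : Fin n) : η a • (gam η (Pi.single a 1) * gam η (Pi.single a 1)) = 1 := by
      rw [CliffordAlgebra.ι_sq_scalar, Algebra.smul_def, ← map_mul]
      rcases hη a with h | h <;>
        simp [quad, QuadraticMap.weightedSumSquares_apply, Pi.single_apply, h]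
    rw [Finset.sum_congr rfl fun a _ => h a, Finset.sum_const, Finset.card_univ, Fintype.card_fin,
      Nat.cast_smul_eq_nsmul]
  g_of_neg k hk := cliffPow_of_neg η H hk
  ι_mul_g_sub k v := gam_mul_cliffPow_sub η hH k v
  g_mul_g k l := cliffPow_mul_comm hη hH k l
  euler k := by
    have hinv : CliffordAlgebra.involute (toForm η (cliffPow η H k))
      = toForm η (cliffPow η H k) := by
      rw [toForm_cliffPow, involute_divPow hH]
    apply (toForm η).injective
    have h1 (a : Fin n) : toForm η (η a • (gam η (Pi.single a 1) * (gam η (Pi.single a 1)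
        * cliffPow η H k - cliffPow η H k * gam η (Pi.single a 1))))
        = (2 : ℝ) • (coframe a * hookDown a (divPow H k)) := by
      rw [map_smul, toForm_gam_mul, toForm_comm_of_even η _ hinv, map_smul, toForm_cliffPow,
        hookDown_eq hη, hook, CliffordAlgebra.contractLeft_contractLeft, smul_zero, add_zero,
        mul_smul_comm, mul_smul_comm, smul_comm]
      rfl
    rw [map_sum, Finset.sum_congr rfl fun a _ => h1 a, ← Finset.smul_sum, map_smul,
      toForm_cliffPow]
    rcases lt_or_ge k 0 with hk | hk
    · simp [divPow_of_neg H hk]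
    · lift k to ℕ using hk
      rw [sum_coframe_mul_hookDown (divPow_mem hH k), smul_smul]
      congr 1
      push_cast
      ring

/-! ### The Hodge dual and the volume form -/

theorem hookDown_mem {p : ℕ} (a : Fin n) {x : Form n} (hx : x ∈ ⋀[ℝ]^p (Fin n → ℝ)) :
    hookDown a x ∈ ⋀[ℝ]^(p - 1) (Fin n → ℝ) := hook_mem _ hx

theorem hookDown_vec_mul (a : Fin n) (v : Fin n → ℝ) (x : Form n) :
    hookDown a (vec v * x) = v a • x - vec v * hookDown a x := hook_vec_mul _ v x

theorem sum_hookUp (η v : Fin n → ℝ) (x : Form n) :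
    ∑ a, v a • hookUp η a x = hook (dual η v) x := by
  have h : dual η v = ∑ a, v a • dual η (Pi.single a 1) := by
    refine LinearMap.ext fun u => ?_
    simp only [dual_apply, LinearMap.sum_apply, LinearMap.smul_apply, Pi.single_apply, mul_ite,
      mul_one, mul_zero, ite_mul, zero_mul, Finset.sum_ite_eq',
      Finset.mem_univ, if_true, smul_eq_mul]
    exact Finset.sum_congr rfl fun a _ => by ring
  simp only [hookUp_eq]
  rw [h, hook, map_sum, LinearMap.sum_apply]
  simp

/-- The contracted wedge product as a bilinear map. -/
def cwedgeBilin (η : Fin n → ℝ) : ℕ → Form n →ₗ[ℝ] Form n →ₗ[ℝ] Form n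
  | 0 => LinearMap.mul ℝ (Form n)
  | k + 1 => ∑ a, (cwedgeBilin η k).compl₁₂ (hookDown a) (hookUp η a)

theorem cwedge_eq (η : Fin n → ℝ) (k : ℕ) (α β : Form n) :
    cwedge η k α β = cwedgeBilin η k α β := by
  induction k generalizing α β with
  | zero => rfl
  | succ k ih => simp [cwedge, cwedgeBilin, ih]

theorem cwedgeBilin_succ (η : Fin n → ℝ) (k : ℕ) (α β : Form n) :
    cwedgeBilin η (k + 1) α β = ∑ a, cwedgeBilin η k (hookDown a α) (hookUp η a β) := by
  simp [cwedgeBilin]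

theorem cwedgeBilin_vec_mul (η v : Fin n → ℝ) {p : ℕ} {α : Form n}
    (hα : α ∈ ⋀[ℝ]^p (Fin n → ℝ)) (β : Form n) :
    cwedgeBilin η (p + 1) (vec v * α) β
      = (p + 1 : ℝ) • cwedgeBilin η p α (hook (dual η v) β) := by
  have hsum (p : ℕ) (α β : Form n) : ∑ a, cwedgeBilin η p (v a • α) (hookUp η a β)
      = cwedgeBilin η p α (hook (dual η v) β) := by
    rw [← sum_hookUp, map_sum]
    simp
  induction p generalizing α β with
  | zero =>
    have h0 (a : Fin n) : hookDown a α = 0 := hook_mem_zero _ hα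
    rw [cwedgeBilin_succ]
    simp only [hookDown_vec_mul, h0, mul_zero, sub_zero, hsum]
    simp
  | succ p ih =>
    rw [cwedgeBilin_succ]
    simp only [hookDown_vec_mul, map_sub, LinearMap.sub_apply, Finset.sum_sub_distrib, hsum]
    have h (a : Fin n) : cwedgeBilin η (p + 1) (vec v * hookDown a α) (hookUp η a β)
        = -((p + 1 : ℝ) • cwedgeBilin η p (hookDown a α) (hookUp η a (hook (dual η v) β))) := by
      rw [ih (hookDown_mem a hα), hookUp_eq, hook_hook, map_neg, smul_neg]
    rw [Finset.sum_congr rfl fun a _ => h a, Finset.sum_neg_distrib, ← Finset.smul_sum,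
      ← cwedgeBilin_succ]
    push_cast
    module

theorem hook_cwedgeBilin (η : Fin n → ℝ) (d : Module.Dual ℝ (Fin n → ℝ)) {p : ℕ} {α : Form n}
    (hα : α ∈ ⋀[ℝ]^p (Fin n → ℝ)) (β : Form n) :
    hook d (cwedgeBilin η p α β) = (-1 : ℝ) ^ p • cwedgeBilin η p α (hook d β) := by
  induction p generalizing α β with
  | zero =>
    obtain ⟨r, rfl⟩ := exists_algebraMap_of_mem_zero hα
    simp [cwedgeBilin, ← Algebra.smul_def]
  | succ p ih =>
    rw [cwedgeBilin_succ, cwedgeBilin_succ, map_sum, Finset.smul_sum]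
    refine Finset.sum_congr rfl fun a _ => ?_
    rw [ih (hookDown_mem a hα), hookUp_eq, hook_hook, map_neg, pow_succ]
    simp

theorem levi_mem : (levi : Form n) ∈ ⋀[ℝ]^n (Fin n → ℝ) := by
  have h := SetLike.list_prod_ofFn_mem_graded (A := fun i : ℕ => ⋀[ℝ]^i (Fin n → ℝ))
    (fun _ : Fin n => 1) (fun a : Fin n => (coframe a : Form n)) (fun a => by
      have := vec_mul_mem (Pi.single a 1) (x := 1) (p := 0)
        (by rw [ExteriorAlgebra.exteriorPower, pow_zero]; exact Submodule.one_le.1 le_rfl)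
      rw [mul_one] at this
      exact this)
  rw [levi]
  simpa [List.sum_ofFn] using h

/-- The Levi-Civita form as an element of the Clifford algebra. -/
def vol (η : Fin n → ℝ) : Cl η := (toForm η).symm levi

theorem toForm_vol (η : Fin n → ℝ) : toForm η (vol η) = levi := (toForm η).apply_symm_apply _

theorem involute_vol (η : Fin n → ℝ) :
    CliffordAlgebra.involute (vol η) = (-1 : ℝ) ^ n • vol η := by
  apply (toForm η).injective
  rw [toForm_involute, map_smul, toForm_vol, involute_of_mem levi_mem]

theorem involute_vol_mul_gam (η v : Fin n → ℝ) :
    CliffordAlgebra.involute (vol η) * gam η v = -(gam η v * vol η) := by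
  have h : vec v * levi = 0 := exteriorPower_eq_zero (Nat.lt_succ_self n) (vec_mul_mem v levi_mem)
  apply (toForm η).injective
  rw [toForm_mul_gam, map_neg, toForm_gam_mul, toForm_involute,
    CliffordAlgebra.involute_involute, toForm_vol, h]
  abel

theorem vol_mul_gam (η v : Fin n → ℝ) :
    vol η * gam η v = -((-1 : ℝ) ^ n • (gam η v * vol η)) := by
  have h := involute_vol_mul_gam η v
  rw [involute_vol, smul_mul_assoc] at h
  have h2 := congrArg (fun x => (-1 : ℝ) ^ n • x) h
  simp only [smul_smul, ← mul_pow] at h2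
  simpa using h2

theorem two_vec_mul_toForm (η v : Fin n → ℝ) (x : Cl η) :
    (2 : ℝ) • (vec v * toForm η x)
      = toForm η (gam η v * x + CliffordAlgebra.involute x * gam η v) := by
  rw [map_add, toForm_gam_mul, toForm_mul_gam, toForm_involute, CliffordAlgebra.involute_involute]
  module

theorem two_hook_toForm (η v : Fin n → ℝ) (x : Cl η) :
    (2 : ℝ) • hook (dual η v) (toForm η x)
      = toForm η (gam η v * x - CliffordAlgebra.involute x * gam η v) := by
  rw [map_sub, toForm_gam_mul, toForm_mul_gam, toForm_involute, CliffordAlgebra.involute_involute]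
  module

/-- Contraction is conjugate to the wedge product under Clifford multiplication by the volume
form. -/
theorem hook_toForm_mul_vol (η v : Fin n → ℝ) (x : Cl η) :
    hook (dual η v) (toForm η (x * vol η))
      = toForm η ((toForm η).symm (vec v * toForm η x) * vol η) := by
  apply smul_right_injective _ (two_ne_zero (α := ℝ))
  dsimp only
  rw [two_hook_toForm, ← map_smul, ← smul_mul_assoc, ← map_smul, two_vec_mul_toForm,
    LinearEquiv.symm_apply_apply, map_mul, mul_assoc _ _ (gam η v), involute_vol_mul_gam]
  congr 1
  noncomm_ring

theorem hookDown_eq_vec {η : Fin n → ℝ} (hη : ∀ a, η a = 1 ∨ η a = -1) {H : Form n}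
    (hH : H ∈ ⋀[ℝ]^2 (Fin n → ℝ)) (a : Fin n) :
    hookDown a H = η a • vec (endo η H (Pi.single a 1)) := by
  rw [vec_endo η hH, hookDown_eq hη]

theorem hodge_of_mem (η : Fin n → ℝ) {p : ℕ} {α : Form n} (hα : α ∈ ⋀[ℝ]^p (Fin n → ℝ)) :
    hodge η α = (p.factorial : ℝ)⁻¹ • cwedgeBilin η p α levi := by
  have h (q : ℕ) : (1 / (q.factorial : ℝ)) • cwedge η q (part q α) levi
      = if p = q then (p.factorial : ℝ)⁻¹ • cwedgeBilin η p α levi else 0 := by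
    rw [part_of_mem hα, cwedge_eq]
    split_ifs with h
    · subst h; rw [one_div]
    · simp
  rw [hodge, Finset.sum_congr rfl fun q _ => h q, Finset.sum_ite_eq]
  split_ifs with hp
  · rfl
  · rw [exteriorPower_eq_zero (by simpa using hp) hα]; simp

/-- Contracting `H ^ k / k!` completely with the Levi-Civita form is, up to a factor, Clifford
multiplication by the volume form. In the induction step Euler's relation splits two 1-forms off
`H ^ (k + 1)`, and each of them acts on both sides as a contraction. -/
theorem cwedgeBilin_divPow {η : Fin n → ℝ} (hη : ∀ a, η a = 1 ∨ η a = -1) {H : Form n}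
    (hH : H ∈ ⋀[ℝ]^2 (Fin n → ℝ)) (k : ℕ) :
    cwedgeBilin η (2 * k) (divPow H k) levi
      = ((2 * k).factorial * (-1) ^ k : ℝ) • toForm η (cliffPow η H k * vol η) := by
  induction k with
  | zero =>
    have h1 : divPow H ((0 : ℕ) : ℤ) = 1 := by simp [divPow]
    have h2 : cliffPow η H ((0 : ℕ) : ℤ) = 1 := by
      apply (toForm η).injective
      rw [toForm_cliffPow, h1]
      exact (CliffordAlgebra.changeForm_one CliffordAlgebra.changeForm.associated_neg_proof).symm
    rw [h1, h2, one_mul, toForm_vol]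
    simp [cwedgeBilin]
  | succ k ih =>
    have hk := divPow_mem hH k
    have h1 := sum_coframe_mul_hookDown (divPow_mem hH (k + 1))
    have h2 (a : Fin n) : coframe a * hookDown a (divPow H ((k + 1 : ℕ) : ℤ))
        = η a • (vec (Pi.single a 1) * (vec (endo η H (Pi.single a 1)) * divPow H k)) := by
      rw [hookDown, hook_divPow _ hH]
      change coframe a * (hookDown a H * _) = _
      rw [hookDown_eq_vec hη hH]
      push_cast
      rw [add_sub_cancel_right, smul_mul_assoc, mul_smul_comm]
      rfl
    simp only [h2] at h1
    have h3 (a : Fin n) : cwedgeBilin η (2 * k + 1 + 1)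
        (vec (Pi.single a 1) * (vec (endo η H (Pi.single a 1)) * divPow H k)) levi
        = ((2 * (k + 1)).factorial * (-1) ^ (k + 1) : ℝ) • toForm η ((toForm η).symm
          (vec (Pi.single a 1) * (vec (endo η H (Pi.single a 1)) * divPow H k)) * vol η) := by
      rw [cwedgeBilin_vec_mul η _ (vec_mul_mem _ hk), cwedgeBilin_vec_mul η _ hk]
      have h4 (u v : Fin n → ℝ) :
          cwedgeBilin η (2 * k) (divPow H k) (hook (dual η u) (hook (dual η v) levi))
          = hook (dual η u) (hook (dual η v) (cwedgeBilin η (2 * k) (divPow H k) levi)) := by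
        rw [hook_cwedgeBilin η _ hk, map_smul, hook_cwedgeBilin η _ hk]
        simp [pow_mul]
      rw [h4, ih, map_smul, map_smul, hook_toForm_mul_vol, hook_toForm_mul_vol,
        LinearEquiv.apply_symm_apply, toForm_cliffPow, vec_mul_vec_mul]
      simp only [map_neg, neg_mul, smul_neg, smul_smul]
      rw [← neg_smul]
      congr 1
      rw [show 2 * (k + 1) = 2 * k + 1 + 1 by ring, Nat.factorial_succ, Nat.factorial_succ]
      push_cast
      ring
    have hk2 : ((2 * (k + 1) : ℕ) : ℝ) ≠ 0 := by positivity
    apply smul_right_injective _ hk2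
    dsimp only
    rw [← LinearMap.smul_apply, ← map_smul, ← h1, smul_comm, ← map_smul, ← smul_mul_assoc,
      cliffPow, ← (toForm η).symm.map_smul, ← h1]
    simp only [map_sum, LinearMap.sum_apply, map_smul, LinearMap.smul_apply, Finset.sum_mul,
      smul_mul_assoc, Finset.smul_sum]
    refine Finset.sum_congr rfl fun a _ => ?_
    rw [show 2 * (k + 1) = 2 * k + 1 + 1 by ring] at h3 ⊢
    rw [h3, smul_comm]

theorem hodge_divPow {η : Fin n → ℝ} (hη : ∀ a, η a = 1 ∨ η a = -1) {H : Form n}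
    (hH : H ∈ ⋀[ℝ]^2 (Fin n → ℝ)) (k : ℕ) :
    hodge η (divPow H k) = (-1 : ℝ) ^ k • toForm η (cliffPow η H k * vol η) := by
  rw [hodge_of_mem η (divPow_mem hH k), cwedgeBilin_divPow hη hH, smul_smul, ← mul_assoc,
    inv_mul_cancel₀ (by positivity), one_mul]

theorem pow_eq_divPow (H : Form n) (k : ℕ) : H ^ k = (k.factorial : ℝ) • divPow H k := by
  rw [divPow_natCast, smul_smul, mul_inv_cancel₀ (by positivity), one_smul]

/-- The dual of a `2k`-form has degree `n - 2k`. -/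
theorem toForm_cliffPow_mul_vol_mem {η : Fin n → ℝ} (hη : ∀ a, η a = 1 ∨ η a = -1) {H : Form n}
    (hH : H ∈ ⋀[ℝ]^2 (Fin n → ℝ)) (k : ℕ) :
    toForm η (cliffPow η H k * vol η) ∈ ⋀[ℝ]^(n - 2 * k) (Fin n → ℝ) := by
  have key : ∀ (p : ℕ) (α β : Form n) (q : ℕ), α ∈ ⋀[ℝ]^p (Fin n → ℝ) →
      β ∈ ⋀[ℝ]^q (Fin n → ℝ) → cwedgeBilin η p α β ∈ ⋀[ℝ]^(q - p) (Fin n → ℝ) := by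
    intro p
    induction p with
    | zero =>
      intro α β q hα hβ
      obtain ⟨r, rfl⟩ := exists_algebraMap_of_mem_zero hα
      simp only [cwedgeBilin, LinearMap.mul_apply', ← Algebra.smul_def]
      exact Submodule.smul_mem _ _ hβ
    | succ p ih =>
      intro α β q hα hβ
      rw [cwedgeBilin_succ, show q - (p + 1) = q - 1 - p by omega]
      refine Submodule.sum_mem _ fun a _ => ih _ _ _ (hookDown_mem a hα) ?_
      exact Submodule.smul_mem _ _ (hookDown_mem a hβ)
  have h := key (2 * k) _ _ n (divPow_mem hH k) levi_mem
  rw [cwedgeBilin_divPow hη hH] at h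
  have hc : ((2 * k).factorial * (-1) ^ k : ℝ) ≠ 0 := by
    refine mul_ne_zero (by positivity) (pow_ne_zero _ (by norm_num))
  exact (Submodule.smul_mem_iff _ hc).1 h

/-! ### Infinitesimal rotations and the volume form -/

theorem cwedge_one (η : Fin n → ℝ) (σ φ : Form n) :
    cwedge η 1 σ φ = ∑ a, hookDown a σ * hookUp η a φ := rfl

theorem hookUp_mul_of_mem_two (η : Fin n → ℝ) (a : Fin n) {H : Form n}
    (hH : H ∈ ⋀[ℝ]^2 (Fin n → ℝ)) (y : Form n) :
    hookUp η a (H * y) = hookUp η a H * y + H * hookUp η a y := by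
  rw [hookUp_eq, hook_mul, involute_of_mem hH]; simp

/-- A 2-form acts on forms as a derivation, by `φ ↦ σ ∧_1 φ`. -/
theorem cwedge_one_mul (η : Fin n → ℝ) (σ : Form n) {H : Form n}
    (hH : H ∈ ⋀[ℝ]^2 (Fin n → ℝ)) (y : Form n) :
    cwedge η 1 σ (H * y) = cwedge η 1 σ H * y + H * cwedge η 1 σ y := by
  simp only [cwedge_one, hookUp_mul_of_mem_two η _ hH, mul_add, Finset.sum_add_distrib,
    Finset.sum_mul, Finset.mul_sum, mul_assoc]
  congr 1
  refine Finset.sum_congr rfl fun a _ => ?_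
  rw [← mul_assoc, ← mul_comm_of_mem_two hH, mul_assoc]

theorem cwedge_one_mem (η : Fin n → ℝ) {σ H : Form n} (hσ : σ ∈ ⋀[ℝ]^2 (Fin n → ℝ))
    (hH : H ∈ ⋀[ℝ]^2 (Fin n → ℝ)) : cwedge η 1 σ H ∈ ⋀[ℝ]^2 (Fin n → ℝ) := by
  rw [cwedge_one]
  refine Submodule.sum_mem _ fun a _ => ?_
  exact SetLike.mul_mem_graded (A := fun i : ℕ => ⋀[ℝ]^i (Fin n → ℝ)) (hookDown_mem a hσ)
    (Submodule.smul_mem _ _ (hookDown_mem a hH))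

theorem vec_mul_toForm_mul_vol (η v : Fin n → ℝ) (x : Cl η) :
    vec v * toForm η (x * vol η)
      = toForm η ((toForm η).symm (hook (dual η v) (toForm η x)) * vol η) := by
  apply smul_right_injective _ (two_ne_zero (α := ℝ))
  dsimp only
  rw [two_vec_mul_toForm, ← map_smul, ← smul_mul_assoc, ← map_smul, two_hook_toForm,
    LinearEquiv.symm_apply_apply, map_mul, mul_assoc _ _ (gam η v), involute_vol_mul_gam]
  congr 1
  noncomm_ring

theorem hook_vec (d : Module.Dual ℝ (Fin n → ℝ)) (v : Fin n → ℝ) :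
    hook d (vec v) = algebraMap ℝ (Form n) (d v) :=
  CliffordAlgebra.contractLeft_ι 0 d v

theorem hookDown_vec (a : Fin n) (v : Fin n → ℝ) :
    hookDown a (vec v) = algebraMap ℝ (Form n) (v a) :=
  hook_vec (LinearMap.proj a : (Fin n → ℝ) →ₗ[ℝ] ℝ) v

theorem hookDown_vec_mul_vec (a : Fin n) (u w : Fin n → ℝ) :
    hookDown a (vec u * vec w) = u a • vec w - w a • vec u := by
  rw [hookDown_vec_mul, hookDown_vec, ← Algebra.commutes, Algebra.smul_def (w a)]

theorem cwedge_one_vec_mul_vec (η u w : Fin n → ℝ) (φ : Form n) :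
    cwedge η 1 (vec u * vec w) φ = vec w * hook (dual η u) φ - vec u * hook (dual η w) φ := by
  rw [cwedge_one, ← sum_hookUp, ← sum_hookUp, Finset.mul_sum, Finset.mul_sum,
    ← Finset.sum_sub_distrib]
  refine Finset.sum_congr rfl fun a _ => ?_
  rw [hookDown_vec_mul_vec, sub_mul, smul_mul_assoc, smul_mul_assoc, mul_smul_comm, mul_smul_comm]

theorem cwedge_one_vec_mul_vec_toForm_mul_vol (η u w : Fin n → ℝ) (x : Cl η) :
    cwedge η 1 (vec u * vec w) (toForm η (x * vol η))
      = toForm η ((toForm η).symm (cwedge η 1 (vec u * vec w) (toForm η x)) * vol η) := by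
  rw [cwedge_one_vec_mul_vec, cwedge_one_vec_mul_vec, hook_toForm_mul_vol, hook_toForm_mul_vol,
    vec_mul_toForm_mul_vol, vec_mul_toForm_mul_vol, ← map_sub, ← sub_mul, ← map_sub,
    LinearEquiv.apply_symm_apply, LinearEquiv.apply_symm_apply, hook_vec_mul, hook_vec_mul]
  rw [dual_comm η u w]
  congr 3
  abel

/-- The action of a 2-form as an infinitesimal rotation commutes with Clifford multiplication by
the volume form. -/
theorem cwedge_one_toForm_mul_vol (η : Fin n → ℝ) {σ : Form n} (hσ : σ ∈ ⋀[ℝ]^2 (Fin n → ℝ))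
    (x : Cl η) : cwedge η 1 σ (toForm η (x * vol η))
      = toForm η ((toForm η).symm (cwedge η 1 σ (toForm η x)) * vol η) := by
  refine exteriorPower_succ_induction (P := fun σ => cwedge η 1 σ (toForm η (x * vol η))
      = toForm η ((toForm η).symm (cwedge η 1 σ (toForm η x)) * vol η)) hσ
    (fun u y hy => ?_) (fun y z hy hz => ?_)
  · rw [← vec_ιInv_of_mem_one hy]
    exact cwedge_one_vec_mul_vec_toForm_mul_vol η u _ x
  · rw [cwedge_eq, cwedge_eq] at *
    rw [map_add, LinearMap.add_apply, LinearMap.add_apply, map_add, add_mul, map_add, hy, hz]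

/-- Right Clifford multiplication of a form by the volume form. -/
def volMul (η : Fin n → ℝ) : Form n →ₗ[ℝ] Form n :=
  (toForm η).toLinearMap ∘ₗ LinearMap.mulRight ℝ (vol η) ∘ₗ (toForm η).symm.toLinearMap

theorem volMul_toForm (η : Fin n → ℝ) (x : Cl η) :
    volMul η (toForm η x) = toForm η (x * vol η) := by
  simp only [volMul, LinearMap.comp_apply, LinearEquiv.coe_coe, LinearMap.mulRight_apply,
    LinearEquiv.symm_apply_apply]

theorem hook_volMul (η v : Fin n → ℝ) (φ : Form n) :
    hook (dual η v) (volMul η φ) = volMul η (vec v * φ) := by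
  obtain ⟨x, rfl⟩ := (toForm η).surjective φ
  rw [volMul_toForm, hook_toForm_mul_vol]
  rfl

theorem hookUp_volMul (η : Fin n → ℝ) (a : Fin n) (φ : Form n) :
    hookUp η a (volMul η φ) = volMul η (wedgeUp a φ) := by
  rw [hookUp_eq, hook_volMul]; rfl

theorem hookDown_volMul {η : Fin n → ℝ} (hη : ∀ a, η a = 1 ∨ η a = -1) (a : Fin n) (φ : Form n) :
    hookDown a (volMul η φ) = volMul η (wedgeDown η a φ) := by
  rw [hookDown_eq hη, hook_volMul, ← map_smul]; rfl

theorem cwedge_one_volMul (η : Fin n → ℝ) {σ : Form n} (hσ : σ ∈ ⋀[ℝ]^2 (Fin n → ℝ))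
    (φ : Form n) : cwedge η 1 σ (volMul η φ) = volMul η (cwedge η 1 σ φ) := by
  obtain ⟨x, rfl⟩ := (toForm η).surjective φ
  rw [volMul_toForm, cwedge_one_toForm_mul_vol η hσ]
  rfl

theorem hodge_pow {η : Fin n → ℝ} (hη : ∀ a, η a = 1 ∨ η a = -1) {H : Form n}
    (hH : H ∈ ⋀[ℝ]^2 (Fin n → ℝ)) (k : ℕ) :
    hodge η (H ^ k) = (-1 : ℝ) ^ k • volMul η (H ^ k) := by
  have h (φ : Form n) (c : ℝ) : hodge η (c • φ) = c • hodge η φ := by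
    simp only [hodge, cwedge_eq, map_smul, LinearMap.smul_apply, Finset.smul_sum]
    exact Finset.sum_congr rfl fun p _ => smul_comm _ _ _
  rw [pow_eq_divPow, h, hodge_divPow hη hH, map_smul, ← toForm_cliffPow η, volMul_toForm,
    smul_comm]

theorem volMul_divPow_mem {η : Fin n → ℝ} (hη : ∀ a, η a = 1 ∨ η a = -1) {H : Form n}
    (hH : H ∈ ⋀[ℝ]^2 (Fin n → ℝ)) (k : ℕ) :
    volMul η (divPow H k) ∈ ⋀[ℝ]^(n - 2 * k) (Fin n → ℝ) := by
  rw [← toForm_cliffPow η, volMul_toForm]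
  exact toForm_cliffPow_mul_vol_mem hη hH k

theorem volMul_vec_mul_divPow_mem {η : Fin n → ℝ} (hη : ∀ a, η a = 1 ∨ η a = -1) {H : Form n}
    (hH : H ∈ ⋀[ℝ]^2 (Fin n → ℝ)) (v : Fin n → ℝ) (k : ℕ) :
    volMul η (vec v * divPow H k) ∈ ⋀[ℝ]^(n - 2 * k - 1) (Fin n → ℝ) := by
  rw [← hook_volMul]
  exact hook_mem _ (volMul_divPow_mem hη hH k)

/-! ### Differentiation of form-valued functions -/

theorem eq_sum_repr {M : Type*} (α : M → Form n) : α = fun y => ∑ s,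
    (Pi.basisFun ℝ (Fin n)).ExteriorAlgebra.repr (α y) s •
      (Pi.basisFun ℝ (Fin n)).ExteriorAlgebra s :=
  funext fun y => ((Pi.basisFun ℝ (Fin n)).ExteriorAlgebra.sum_repr (α y)).symm

theorem mul_eq_sum_repr {M : Type*} (α β : M → Form n) : (fun y => α y * β y)
    = fun y => ∑ p : Finset (Fin n) × Finset (Fin n),
      ((Pi.basisFun ℝ (Fin n)).ExteriorAlgebra.repr (α y) p.1 *
        (Pi.basisFun ℝ (Fin n)).ExteriorAlgebra.repr (β y) p.2) •
      ((Pi.basisFun ℝ (Fin n)).ExteriorAlgebra p.1 *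
        (Pi.basisFun ℝ (Fin n)).ExteriorAlgebra p.2) := by
  ext y
  conv_lhs => rw [eq_sum_repr α, eq_sum_repr β]
  simp only [Finset.sum_mul_sum, Fintype.sum_prod_type, smul_mul_smul_comm]

section Geometry

variable {M : Type*} [TopologicalSpace M] [ChartedSpace (EuclideanSpace ℝ (Fin n)) M]

/-- The components of a form-valued function are differentiable at a point. -/
def FormDiffAt (α : M → Form n) (x : M) : Prop :=
  ∀ s, MDifferentiableAt (𝓡 n) 𝓘(ℝ, ℝ)
    (fun y => (Pi.basisFun ℝ (Fin n)).ExteriorAlgebra.repr (α y) s) x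

theorem mdifferentiableAt_sum_mul {ι : Type} [Fintype ι] {f : ι → M → ℝ} {x : M}
    (hf : ∀ i, MDifferentiableAt (𝓡 n) 𝓘(ℝ, ℝ) (f i) x) (c : ι → ℝ) :
    MDifferentiableAt (𝓡 n) 𝓘(ℝ, ℝ) (fun y => ∑ i, c i * f i y) x := by
  have h : (fun y => ∑ i, c i * f i y) = ∑ i, c i • f i := by
    ext y; simp
  rw [h]
  have h1 : ∀ i ∈ (Finset.univ : Finset ι),
      MDifferentiableAt (𝓡 n) 𝓘(ℝ, ℝ) (c i • f i) x := fun i _ => (hf i).const_smul (c i)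
  exact MDifferentiableAt.sum (t := Finset.univ) (f := fun i => c i • f i) h1

theorem lieFun_sum_mul {ι : Type} [Fintype ι] (V : ∀ x : M, TangentSpace (𝓡 n) x)
    {f : ι → M → ℝ} {x : M}
    (hf : ∀ i, MDifferentiableAt (𝓡 n) 𝓘(ℝ, ℝ) (f i) x) (c : ι → ℝ) :
    lieFun V (fun y => ∑ i, c i * f i y) x = ∑ i, c i * lieFun V (f i) x := by
  have h : (fun y => ∑ i, c i * f i y) = ∑ i, c i • f i := by
    ext y; simp
  have h0 : ∀ i ∈ (Finset.univ : Finset ι), HasMFDerivAt (𝓡 n) 𝓘(ℝ, ℝ) (c i • f i) x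
      (c i • mfderiv (𝓡 n) 𝓘(ℝ, ℝ) (f i) x) :=
    fun i _ => ((hf i).hasMFDerivAt).const_smul (c i)
  have h1 := HasMFDerivAt.sum (t := Finset.univ) (f := fun i => c i • f i)
    (f' := fun i => c i • mfderiv (𝓡 n) 𝓘(ℝ, ℝ) (f i) x) h0
  rw [lieFun, h, h1.mfderiv]
  have key (L : ι → EuclideanSpace ℝ (Fin n) →L[ℝ] ℝ) (v : EuclideanSpace ℝ (Fin n)) :
      (∑ i, c i • L i) v = ∑ i, c i * L i v := by simp
  exact key (fun i => mfderiv (𝓡 n) 𝓘(ℝ, ℝ) (f i) x) (V x)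

theorem mdifferentiableAt_mul {f g : M → ℝ} {x : M}
    (hf : MDifferentiableAt (𝓡 n) 𝓘(ℝ, ℝ) f x) (hg : MDifferentiableAt (𝓡 n) 𝓘(ℝ, ℝ) g x) :
    MDifferentiableAt (𝓡 n) 𝓘(ℝ, ℝ) (fun y => f y * g y) x := hf.mul hg

theorem lieFun_const (V : ∀ x : M, TangentSpace (𝓡 n) x) (c : ℝ) (x : M) :
    lieFun V (fun _ => c) x = 0 := by
  rw [lieFun, mfderiv_const]; rfl

theorem lieFun_mul (V : ∀ x : M, TangentSpace (𝓡 n) x) {f g : M → ℝ} {x : M}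
    (hf : MDifferentiableAt (𝓡 n) 𝓘(ℝ, ℝ) f x) (hg : MDifferentiableAt (𝓡 n) 𝓘(ℝ, ℝ) g x) :
    lieFun V (fun y => f y * g y) x = lieFun V f x * g x + f x * lieFun V g x := by
  have h1 := (hf.hasMFDerivAt).mul (hg.hasMFDerivAt)
  have h : (fun y => f y * g y) = f * g := rfl
  rw [lieFun, h, h1.mfderiv]
  change f x * _ + g x * _ = _
  rw [add_comm, mul_comm (g x)]
  rfl

theorem formDiffAt_sum_smul {ι : Type} [Fintype ι] {f : ι → M → ℝ} {x : M}
    (hf : ∀ i, MDifferentiableAt (𝓡 n) 𝓘(ℝ, ℝ) (f i) x) (w : ι → Form n) :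
    FormDiffAt (fun y => ∑ i, f i y • w i) x := by
  intro s
  have := mdifferentiableAt_sum_mul hf fun i => (Pi.basisFun ℝ (Fin n)).ExteriorAlgebra.repr (w i) s
  simpa [mul_comm, Finsupp.finsetSum_apply] using this

theorem mdifferentiableAt_repr_mul_repr {α β : M → Form n} {x : M} (hα : FormDiffAt α x)
    (hβ : FormDiffAt β x) (p : Finset (Fin n) × Finset (Fin n)) :
    MDifferentiableAt (𝓡 n) 𝓘(ℝ, ℝ) (fun y =>
      (Pi.basisFun ℝ (Fin n)).ExteriorAlgebra.repr (α y) p.1 *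
        (Pi.basisFun ℝ (Fin n)).ExteriorAlgebra.repr (β y) p.2) x := by
  have h1 := hα p.1
  have h2 := hβ p.2
  exact mdifferentiableAt_mul h1 h2

theorem FormDiffAt.mul {α β : M → Form n} {x : M} (hα : FormDiffAt α x) (hβ : FormDiffAt β x) :
    FormDiffAt (fun y => α y * β y) x := by
  rw [mul_eq_sum_repr]
  exact formDiffAt_sum_smul (mdifferentiableAt_repr_mul_repr hα hβ) _

theorem formDiffAt_const (c : Form n) (x : M) : FormDiffAt (fun _ : M => c) x :=
  fun _ => mdifferentiableAt_const

theorem FormDiffAt.pow {α : M → Form n} {x : M} (hα : FormDiffAt α x) (k : ℕ) :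
    FormDiffAt (fun y => α y ^ k) x := by
  induction k with
  | zero => simpa only [pow_zero] using formDiffAt_const 1 x
  | succ k ih => simpa only [pow_succ'] using hα.mul ih

variable [IsManifold (𝓡 n) ∞ M] {g : PseudoRiemannianMetric n M} {U : Set M}
  (F : OrthonormalFrame g U)

theorem deriv_sum_smul {ι : Type} [Fintype ι] {f : ι → M → ℝ} {x : M}
    (hf : ∀ i, MDifferentiableAt (𝓡 n) 𝓘(ℝ, ℝ) (f i) x) (w : ι → Form n) (a : Fin n) :
    F.deriv a (fun y => ∑ i, f i y • w i) x = ∑ i, lieFun (F.vec a) (f i) x • w i := by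
  have h (s : Finset (Fin n)) : lieFun (F.vec a) (fun y =>
      (Pi.basisFun ℝ (Fin n)).ExteriorAlgebra.repr (∑ i, f i y • w i) s) x
      = ∑ i, (Pi.basisFun ℝ (Fin n)).ExteriorAlgebra.repr (w i) s * lieFun (F.vec a) (f i) x := by
    rw [← lieFun_sum_mul _ hf]
    congr 1
    ext y
    simp [mul_comm, Finsupp.finsetSum_apply]
  rw [OrthonormalFrame.deriv]
  simp only [h, Finset.sum_smul]
  rw [Finset.sum_comm]
  refine Finset.sum_congr rfl fun i _ => ?_
  conv_rhs => rw [← (Pi.basisFun ℝ (Fin n)).ExteriorAlgebra.sum_repr (w i), Finset.smul_sum]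
  refine Finset.sum_congr rfl fun s _ => ?_
  rw [smul_smul, mul_comm]

theorem deriv_map {α : M → Form n} {x : M} (hα : FormDiffAt α x)
    (L : Form n →ₗ[ℝ] Form n) (a : Fin n) :
    F.deriv a (fun y => L (α y)) x = L (F.deriv a α x) := by
  have h := deriv_sum_smul F hα (fun s => L ((Pi.basisFun ℝ (Fin n)).ExteriorAlgebra s)) a
  have h2 : (fun y => L (α y)) = fun y => ∑ s,
      (Pi.basisFun ℝ (Fin n)).ExteriorAlgebra.repr (α y) s •
        L ((Pi.basisFun ℝ (Fin n)).ExteriorAlgebra s) := by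
    ext y
    conv_lhs => rw [eq_sum_repr α]
    simp only [map_sum, map_smul]
  rw [h2, h, OrthonormalFrame.deriv]
  simp only [map_sum, map_smul]

theorem deriv_mul {α β : M → Form n} {x : M} (hα : FormDiffAt α x) (hβ : FormDiffAt β x)
    (a : Fin n) :
    F.deriv a (fun y => α y * β y) x = F.deriv a α x * β x + α x * F.deriv a β x := by
  rw [mul_eq_sum_repr, deriv_sum_smul F (mdifferentiableAt_repr_mul_repr hα hβ)]
  rw [show α x = _ from congrFun (eq_sum_repr α) x, show β x = _ from congrFun (eq_sum_repr β) x,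
    OrthonormalFrame.deriv, OrthonormalFrame.deriv]
  simp only [Finset.sum_mul_sum, smul_mul_smul_comm, ← Finset.sum_add_distrib, ← add_smul]
  rw [Fintype.sum_prod_type]
  refine Finset.sum_congr rfl fun s _ => Finset.sum_congr rfl fun t _ => ?_
  rw [lieFun_mul _ (hα s) (hβ t)]

theorem deriv_const (c : Form n) (x : M) (a : Fin n) : F.deriv a (fun _ => c) x = 0 := by
  simp only [OrthonormalFrame.deriv, lieFun_const, zero_smul, Finset.sum_const_zero]

end Geometry

/-! ### Covariant derivatives of the towers -/

section Geometry

variable {M : Type*} [TopologicalSpace M] [ChartedSpace (EuclideanSpace ℝ (Fin n)) M]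
  [IsManifold (𝓡 n) ∞ M] {g : PseudoRiemannianMetric n M} {U : Set M}
  (F : OrthonormalFrame g U)

theorem mdifferentiableAt_twoForm (h : TwoForm n M) {x : M} (hx : x ∈ U) (a b : Fin n) :
    MDifferentiableAt (𝓡 n) 𝓘(ℝ, ℝ) (fun y => h.toFun y (F.vec a y) (F.vec b y)) x := by
  have hv (a : Fin n) := (F.contMDiffOn a).contMDiffAt (F.isOpen.mem_nhds hx)
  have h1 := ContMDiffAt.clm_bundle_apply₂ (n := ∞) (F₁ := EuclideanSpace ℝ (Fin n))
    (F₂ := EuclideanSpace ℝ (Fin n)) (F₃ := ℝ) (E₃ := Bundle.Trivial M ℝ)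
    (E₁ := fun x : M => TangentSpace (𝓡 n) x) (E₂ := fun x : M => TangentSpace (𝓡 n) x)
    (b := fun x : M => x) (ψ := h.toFun) (h.contMDiff x) (hv a) (hv b)
  rw [Bundle.contMDiffAt_totalSpace] at h1
  exact h1.2.mdifferentiableAt (by simp)

theorem coframe_mul_coframe_mem (a b : Fin n) :
    (coframe a * coframe b : Form n) ∈ ⋀[ℝ]^2 (Fin n → ℝ) := by
  have h : (coframe b : Form n) ∈ ⋀[ℝ]^1 (Fin n → ℝ) := by
    rw [ExteriorAlgebra.exteriorPower, pow_one]
    exact LinearMap.mem_range_self _ _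
  exact vec_mul_mem _ h

theorem ofTwoForm_mem (h : TwoForm n M) (x : M) :
    F.ofTwoForm h x ∈ ⋀[ℝ]^2 (Fin n → ℝ) :=
  Submodule.smul_mem _ _ (Submodule.sum_mem _ fun a _ => Submodule.sum_mem _ fun b _ =>
    Submodule.smul_mem _ _ (coframe_mul_coframe_mem a b))

theorem connForm_mem (a : Fin n) (x : M) : F.connForm a x ∈ ⋀[ℝ]^2 (Fin n → ℝ) :=
  Submodule.smul_mem _ _ (Submodule.sum_mem _ fun a _ => Submodule.sum_mem _ fun b _ =>
    Submodule.smul_mem _ _ (coframe_mul_coframe_mem a b))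

theorem ofTwoForm_eq_sum (h : TwoForm n M) : F.ofTwoForm h = fun y => ∑ p : Fin n × Fin n,
    h.toFun y (F.vec p.1 y) (F.vec p.2 y) • ((1 / 2 : ℝ) • (coframe p.1 * coframe p.2)) := by
  ext y
  simp only [OrthonormalFrame.ofTwoForm, Fintype.sum_prod_type, Finset.smul_sum]
  exact Finset.sum_congr rfl fun a _ => Finset.sum_congr rfl fun b _ => smul_comm _ _ _

theorem mdifferentiableAt_twoForm_prod (h : TwoForm n M) {x : M} (hx : x ∈ U)
    (p : Fin n × Fin n) : MDifferentiableAt (𝓡 n) 𝓘(ℝ, ℝ)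
      (fun y => h.toFun y (F.vec p.1 y) (F.vec p.2 y)) x :=
  mdifferentiableAt_twoForm F h hx p.1 p.2

theorem formDiffAt_ofTwoForm (h : TwoForm n M) {x : M} (hx : x ∈ U) :
    FormDiffAt (F.ofTwoForm h) x := by
  rw [ofTwoForm_eq_sum]
  exact formDiffAt_sum_smul (mdifferentiableAt_twoForm_prod F h hx) _

theorem deriv_ofTwoForm_mem (h : TwoForm n M) {x : M} (hx : x ∈ U) (a : Fin n) :
    F.deriv a (F.ofTwoForm h) x ∈ ⋀[ℝ]^2 (Fin n → ℝ) := by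
  rw [ofTwoForm_eq_sum, deriv_sum_smul F (mdifferentiableAt_twoForm_prod F h hx)]
  exact Submodule.sum_mem _ fun p _ => Submodule.smul_mem _ _
    (Submodule.smul_mem _ _ (coframe_mul_coframe_mem p.1 p.2))

theorem nabla_ofTwoForm_mem (h : TwoForm n M) {x : M} (hx : x ∈ U) (a : Fin n) :
    F.nabla a (F.ofTwoForm h) x ∈ ⋀[ℝ]^2 (Fin n → ℝ) :=
  Submodule.sub_mem _ (deriv_ofTwoForm_mem F h hx a)
    (cwedge_one_mem F.η (connForm_mem F a x) (ofTwoForm_mem F h x))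

theorem nabla_mul {α β : M → Form n} {x : M} (hα : FormDiffAt α x) (hβ : FormDiffAt β x)
    (h2 : α x ∈ ⋀[ℝ]^2 (Fin n → ℝ)) (a : Fin n) :
    F.nabla a (fun y => α y * β y) x = F.nabla a α x * β x + α x * F.nabla a β x := by
  simp only [OrthonormalFrame.nabla, deriv_mul F hα hβ, cwedge_one_mul F.η _ h2]
  noncomm_ring

theorem nabla_const_one (x : M) (a : Fin n) : F.nabla a (fun _ => 1) x = 0 := by
  have h (a : Fin n) : hookUp F.η a (1 : Form n) = 0 := by
    rw [hookUp_eq, ← map_one (algebraMap ℝ (Form n)), hook_algebraMap]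
  simp [OrthonormalFrame.nabla, deriv_const, cwedge_one, h]

theorem nabla_zero (x : M) (a : Fin n) : F.nabla a (fun _ => 0) x = 0 := by
  simp [OrthonormalFrame.nabla, deriv_const, cwedge_one]

theorem nabla_pow_succ {α : M → Form n} {x : M} (hα : FormDiffAt α x)
    (h2 : α x ∈ ⋀[ℝ]^2 (Fin n → ℝ)) (a : Fin n) (k : ℕ) :
    F.nabla a (fun y => α y ^ (k + 1)) x = (k + 1 : ℝ) • (F.nabla a α x * α x ^ k) := by
  induction k with
  | zero => simp
  | succ k ih =>
    simp only [pow_succ' _ (k + 1)]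
    rw [nabla_mul F hα (hα.pow (k + 1)) h2, ih, mul_smul_comm, ← mul_assoc,
      mul_comm_of_mem_two h2, mul_assoc, ← pow_succ']
    push_cast
    module

/-- The covariant derivative commutes with a constant linear map that is invariant under
infinitesimal rotations. -/
theorem nabla_map {α : M → Form n} {x : M} (hα : FormDiffAt α x) (L : Form n →ₗ[ℝ] Form n)
    (hL : ∀ σ ∈ ⋀[ℝ]^2 (Fin n → ℝ), ∀ φ, cwedge F.η 1 σ (L φ) = L (cwedge F.η 1 σ φ))
    (a : Fin n) : F.nabla a (fun y => L (α y)) x = L (F.nabla a α x) := by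
  rw [OrthonormalFrame.nabla, OrthonormalFrame.nabla, deriv_map F hα,
    hL _ (connForm_mem F a x), map_sub]

/-- A closed conformal Killing-Yano 2-form satisfies `∇_a h = e_a ∧ ξ` for a 1-form `ξ`. -/
theorem exists_nabla_eq_of_isCCKY {g : PseudoRiemannianMetric n M} (F : OrthonormalFrame g U)
    {h : TwoForm n M} (hh : h.IsCCKY g) {x : M} (hx : x ∈ U) :
    ∃ ξ : Fin n → ℝ, ∀ a, F.nabla a (F.ofTwoForm h) x = wedgeDown F.η a (vec ξ) := by
  obtain ⟨h1, h2⟩ := hh U F x hx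
  have h3 : F.codiff (F.ofTwoForm h) x ∈ ⋀[ℝ]^1 (Fin n → ℝ) :=
    Submodule.neg_mem _ (Submodule.sum_mem _ fun a _ =>
      Submodule.smul_mem _ _ (hookDown_mem a (nabla_ofTwoForm_mem F h hx a)))
  refine ⟨-((1 / ((n : ℝ) - (2 : ℕ) + 1)) • ExteriorAlgebra.ιInv (F.codiff (F.ofTwoForm h) x)),
    fun a => ?_⟩
  have h4 : wedgeDown F.η a (F.codiff (F.ofTwoForm h) x) ∈ ⋀[ℝ]^2 (Fin n → ℝ) :=
    Submodule.smul_mem _ _ (vec_mul_mem _ h3)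
  have h5 := h1 a
  rw [OrthonormalFrame.twistor, h2, map_zero, map_zero, sub_zero, degMap_of_mem _ h4] at h5
  rw [map_neg, map_smul, vec_ιInv_of_mem_one h3, map_neg, map_smul]
  exact eq_neg_of_add_eq_zero_left h5

theorem towerH_eq_zero (h : TwoForm n M) {k : ℕ} (hk : n < 2 * k) :
    F.towerH h k = fun _ => 0 := by
  ext y
  rw [OrthonormalFrame.towerH, pow_eq_divPow,
    exteriorPower_eq_zero hk (divPow_mem (ofTwoForm_mem F h y) k), smul_zero]

theorem towerF_apply (h : TwoForm n M) (k : ℕ) (y : M) :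
    F.towerF h k y = (-1 : ℝ) ^ k • volMul F.η (F.towerH h k y) :=
  hodge_pow F.η_eq (ofTwoForm_mem F h y) k

theorem towerF_eq (h : TwoForm n M) (k : ℕ) :
    F.towerF h k = fun y => ((-1 : ℝ) ^ k • volMul F.η) (F.towerH h k y) :=
  funext (towerF_apply F h k)

variable {F} {h : TwoForm n M} {x : M} {ξ : Fin n → ℝ}

theorem nabla_towerH (hx : x ∈ U)
    (hξ : ∀ a, F.nabla a (F.ofTwoForm h) x = wedgeDown F.η a (vec ξ)) (k : ℕ) (a : Fin n) :
    F.nabla a (F.towerH h k) x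
      = wedgeDown F.η a ((k.factorial : ℝ) • (vec ξ * divPow (F.ofTwoForm h x) (k - 1))) := by
  cases k with
  | zero =>
    rw [Nat.cast_zero, divPow_of_neg _ (by norm_num), mul_zero, smul_zero, map_zero,
      ← nabla_const_one F x a]
    congr 1
    ext y
    exact pow_zero _
  | succ k =>
    have h1 := nabla_pow_succ F (formDiffAt_ofTwoForm F h hx) (ofTwoForm_mem F h x) a k
    refine h1.trans ?_
    rw [hξ, pow_eq_divPow, Nat.cast_succ, add_sub_cancel_right, Nat.factorial_succ]
    simp only [wedgeDown, wedgeUp, LinearMap.smul_apply, LinearMap.mulLeft_apply, mul_smul_comm,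
      smul_mul_assoc, mul_assoc, smul_smul]
    congr 1
    push_cast
    ring

theorem nabla_towerF (hx : x ∈ U) (k : ℕ) (a : Fin n) :
    F.nabla a (F.towerF h k) x = (-1 : ℝ) ^ k • volMul F.η (F.nabla a (F.towerH h k) x) := by
  rw [towerF_eq]
  refine nabla_map F ((formDiffAt_ofTwoForm F h hx).pow k) _ (fun σ hσ φ => ?_) a
  rw [LinearMap.smul_apply, cwedge_eq, map_smul, ← cwedge_eq, cwedge_one_volMul _ hσ]
  rfl

/-- The zeroth-order term has degree `2k - 1`. The condition `2k ≤ n` keeps the denominator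
`2 (n - (2k - 1))` away from zero. -/
theorem zeroM_towerH (hx : x ∈ U)
    (hξ : ∀ a, F.nabla a (F.ofTwoForm h) x = wedgeDown F.η a (vec ξ)) {k : ℕ} (hk : 2 * k ≤ n) :
    F.zeroM (F.towerH h k) x = ((n - 2 * k : ℝ) / 2) •
      ((k.factorial : ℝ) • (vec ξ * divPow (F.ofTwoForm h x) (k - 1))) := by
  have hq : (k.factorial : ℝ) • (vec ξ * divPow (F.ofTwoForm h x) (k - 1))
      ∈ ⋀[ℝ]^(2 * k - 1) (Fin n → ℝ) := by
    cases k with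
    | zero => simp [divPow_of_neg]
    | succ k =>
      rw [Nat.cast_succ, add_sub_cancel_right, show 2 * (k + 1) - 1 = 2 * k + 1 by omega]
      exact Submodule.smul_mem _ _ (vec_mul_mem _ (divPow_mem (ofTwoForm_mem F h x) k))
  have h1 := sum_hookDown_coframe_mul hq
  have h2 : F.codiff (F.towerH h k) x = -((n - (2 * k - 1 : ℕ) : ℝ) •
      ((k.factorial : ℝ) • (vec ξ * divPow (F.ofTwoForm h x) (k - 1)))) := by
    rw [OrthonormalFrame.codiff, ← h1]
    congr 1
    refine Finset.sum_congr rfl fun a _ => ?_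
    rw [nabla_towerH hx hξ, hookUp, wedgeDown, LinearMap.smul_apply, LinearMap.smul_apply,
      map_smul, smul_smul]
    rcases F.η_eq a with h | h <;> simp [h, wedgeUp]
  rw [OrthonormalFrame.zeroM, h2, map_neg, map_smul, degMap_of_mem _ hq, neg_neg, smul_smul]
  rcases Nat.eq_zero_or_pos k with rfl | hk0
  · rw [Nat.cast_zero, divPow_of_neg _ (by norm_num), mul_zero, smul_zero, smul_zero, smul_zero]
  · congr 1
    have h3 : (2 * k : ℝ) ≤ n := by exact_mod_cast hk
    have h4 : (n - (2 * k - 1) : ℝ) ≠ 0 := by linarith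
    rw [Nat.cast_sub (by omega)]
    push_cast
    field_simp
    ring

/-- The degrees of `d f^(k)` and `δ h^(k)` are `n - 2k + 1` and `2k - 1`, so that both zeroth-order
terms carry the factor `(n - 2k) / 2`. -/
theorem zeroK_towerF (hx : x ∈ U)
    (hξ : ∀ a, F.nabla a (F.ofTwoForm h) x = wedgeDown F.η a (vec ξ)) {k : ℕ} (hk : 2 * k ≤ n) :
    F.zeroK (F.towerF h k) x = (-1 : ℝ) ^ k • volMul F.η (F.zeroM (F.towerH h k) x) := by
  rw [zeroM_towerH hx hξ hk]
  have h1 (a : Fin n) : wedgeUp a (F.nabla a (F.towerF h k) x) = (-1 : ℝ) ^ k •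
      (coframe a * hookDown a (volMul F.η
        ((k.factorial : ℝ) • (vec ξ * divPow (F.ofTwoForm h x) (k - 1))))) := by
    rw [nabla_towerF hx, nabla_towerH hx hξ, ← hookDown_volMul F.η_eq, map_smul]
    rfl
  rw [OrthonormalFrame.zeroK, OrthonormalFrame.extd]
  simp only [h1]
  rw [← Finset.smul_sum]
  cases k with
  | zero => simp [divPow_of_neg]
  | succ k =>
    rw [Nat.cast_succ, add_sub_cancel_right]
    have h2 : volMul F.η (((k + 1).factorial : ℝ) • (vec ξ * divPow (F.ofTwoForm h x) k))
        ∈ ⋀[ℝ]^(n - 2 * k - 1) (Fin n → ℝ) := by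
      rw [map_smul]
      exact Submodule.smul_mem _ _
        (volMul_vec_mul_divPow_mem F.η_eq (ofTwoForm_mem F h x) ξ k)
    rw [sum_coframe_mul_hookDown h2, map_smul, map_smul, degMap_of_mem _ h2, map_smul _ (_ / _),
      smul_smul (_ - _ : ℕ).cast]
    congr 2
    have h3 : (2 * (k + 1) : ℝ) ≤ n := by exact_mod_cast hk
    have h4 : (n - 2 * k - 1 : ℝ) ≠ 0 := by linarith
    rw [Nat.cast_sub (by omega), Nat.cast_sub (by omega)]
    push_cast
    field_simp
    ring

end Geometry

/-! ### Clifford products with the volume form -/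

theorem cmul_toForm (η : Fin n → ℝ) (x y : Cl η) :
    cmul η (toForm η x) (toForm η y) = toForm η (x * y) := by
  rw [cmul, toForm, LinearEquiv.symm_apply_apply, LinearEquiv.symm_apply_apply]

theorem cmul_smul_toForm (η : Fin n → ℝ) (c d : ℝ) (x y : Cl η) :
    cmul η (c • toForm η x) (d • toForm η y) = (c * d) • toForm η (x * y) := by
  rw [← map_smul, ← map_smul, ← map_smul, ← smul_mul_smul_comm, cmul_toForm]

theorem comm_smul_toForm (η : Fin n → ℝ) (c d : ℝ) (x y : Cl η) :
    comm η (c • toForm η x) (d • toForm η y) = (c * d) • toForm η (x * y - y * x) := by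
  rw [comm, cmul_smul_toForm, cmul_smul_toForm, map_sub, smul_sub, mul_comm d c]

theorem vol_mul_of_odd_dim (hn : Odd n) (η : Fin n → ℝ) (x : Cl η) :
    vol η * x = x * vol η := by
  induction x using CliffordAlgebra.left_induction with
  | algebraMap r => exact (Algebra.commutes r _).symm
  | add x y hx hy => rw [mul_add, add_mul, hx, hy]
  | ι_mul x v hx =>
    have h : vol η * gam η v = gam η v * vol η := by
      rw [vol_mul_gam, hn.neg_one_pow, neg_one_smul, neg_neg]
    rw [← mul_assoc, h, mul_assoc, hx, mul_assoc]

theorem vol_mul_of_even_dim (hn : Even n) (η : Fin n → ℝ) (x : Cl η) :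
    vol η * x = CliffordAlgebra.involute x * vol η := by
  induction x using CliffordAlgebra.left_induction with
  | algebraMap r => rw [AlgHom.commutes]; exact (Algebra.commutes r _).symm
  | add x y hx hy => rw [mul_add, map_add, add_mul, hx, hy]
  | ι_mul x v hx =>
    have h : vol η * gam η v = -(gam η v * vol η) := by
      rw [vol_mul_gam, hn.neg_one_pow, one_smul]
    rw [← mul_assoc, h, neg_mul, mul_assoc, hx, map_mul, CliffordAlgebra.involute_ι, neg_mul,
      neg_mul, mul_assoc]

theorem vol_mul_of_involute_eq_neg (η : Fin n → ℝ) {x : Cl η}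
    (hx : CliffordAlgebra.involute x = -x) : vol η * x = -((-1 : ℝ) ^ n • (x * vol η)) := by
  rcases Nat.even_or_odd n with hn | hn
  · rw [vol_mul_of_even_dim hn, hx, hn.neg_one_pow, one_smul, neg_mul]
  · rw [vol_mul_of_odd_dim hn, hn.neg_one_pow, neg_one_smul, neg_neg]

/-- A form all of whose homogeneous components have odd degree. -/
def IsOddForm (φ : Form n) : Prop := CliffordAlgebra.involute φ = -φ

theorem IsOddForm.smul {φ : Form n} (hφ : IsOddForm φ) (c : ℝ) : IsOddForm (c • φ) := by
  rw [IsOddForm, map_smul, hφ, smul_neg]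

theorem isOddForm_vec_mul (v : Fin n → ℝ) {φ : Form n} (hφ : CliffordAlgebra.involute φ = φ) :
    IsOddForm (vec v * φ) := by
  rw [IsOddForm, map_mul, hφ, CliffordAlgebra.involute_ι, neg_mul]

/-- Moving the volume form past the odd form `β` produces the sign `-(-1) ^ n`. -/
theorem cmul_volMul_volMul (η : Fin n → ℝ) (α : Form n) {β : Form n} (hβ : IsOddForm β) :
    cmul η (volMul η α) (volMul η β)
      = -((-1 : ℝ) ^ n • volMul η (volMul η (cmul η α β))) := by
  obtain ⟨x, rfl⟩ := (toForm η).surjective α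
  obtain ⟨y, rfl⟩ := (toForm η).surjective β
  have hy : CliffordAlgebra.involute y = -y := by
    apply (toForm η).injective
    rw [toForm_involute, map_neg]
    exact hβ
  rw [volMul_toForm, volMul_toForm, cmul_toForm, cmul_toForm, volMul_toForm, volMul_toForm,
    ← map_smul, ← map_neg,
    mul_assoc x, ← mul_assoc (vol η) y, vol_mul_of_involute_eq_neg η hy]
  congr 1
  simp only [neg_mul, mul_neg, smul_mul_assoc, mul_smul_comm, mul_assoc]

theorem comm_volMul_volMul (η : Fin n → ℝ) {α β : Form n} (hα : IsOddForm α) (hβ : IsOddForm β) :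
    comm η (volMul η α) (volMul η β)
      = -((-1 : ℝ) ^ n • volMul η (volMul η (comm η α β))) := by
  rw [comm, cmul_volMul_volMul η α hβ, cmul_volMul_volMul η β hα, comm, map_sub, map_sub]
  module

theorem cmul_volMul_left (hn : Odd n) (η : Fin n → ℝ) (α β : Form n) :
    cmul η (volMul η α) β = volMul η (cmul η α β) := by
  obtain ⟨x, rfl⟩ := (toForm η).surjective α
  obtain ⟨y, rfl⟩ := (toForm η).surjective β
  rw [volMul_toForm, cmul_toForm, cmul_toForm, volMul_toForm, mul_assoc,
    vol_mul_of_odd_dim hn, mul_assoc]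

theorem cmul_volMul_right (η : Fin n → ℝ) (α β : Form n) :
    cmul η α (volMul η β) = volMul η (cmul η α β) := by
  obtain ⟨x, rfl⟩ := (toForm η).surjective α
  obtain ⟨y, rfl⟩ := (toForm η).surjective β
  rw [volMul_toForm, cmul_toForm, cmul_toForm, volMul_toForm, mul_assoc]

theorem comm_volMul_left (hn : Odd n) (η : Fin n → ℝ) (α β : Form n) :
    comm η (volMul η α) β = volMul η (comm η α β) := by
  rw [comm, cmul_volMul_left hn, cmul_volMul_right, comm, map_sub]

theorem cmul_smul_smul (η : Fin n → ℝ) (c d : ℝ) (α β : Form n) :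
    cmul η (c • α) (d • β) = (c * d) • cmul η α β := by
  simp only [cmul, map_smul, smul_mul_smul_comm]

theorem comm_smul_smul (η : Fin n → ℝ) (c d : ℝ) (α β : Form n) :
    comm η (c • α) (d • β) = (c * d) • comm η α β := by
  rw [comm, cmul_smul_smul, cmul_smul_smul, comm, smul_sub, mul_comm d c]

theorem cmul_zero_left (η : Fin n → ℝ) (β : Form n) : cmul η 0 β = 0 := by
  simp [cmul]

theorem cmul_zero_right (η : Fin n → ℝ) (β : Form n) : cmul η β 0 = 0 := by
  simp [cmul]

theorem comm_zero_left (η : Fin n → ℝ) (β : Form n) : comm η 0 β = 0 := by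
  simp [comm, cmul]

theorem comm_zero_right (η : Fin n → ℝ) (β : Form n) : comm η β 0 = 0 := by
  simp [comm, cmul]

/-! ### The tower in terms of forms -/

section Tower

variable {η : Fin n → ℝ} (hη : ∀ a, η a = 1 ∨ η a = -1) {H : Form n}
  (hH : H ∈ ⋀[ℝ]^2 (Fin n → ℝ))

theorem toForm_W (k : ℤ) (v : Fin n → ℝ) :
    toForm η ((tower hη hH).W k v) = (2 : ℝ) • (vec v * divPow H k) := by
  have h : CliffordAlgebra.involute (toForm η (cliffPow η H k)) = toForm η (cliffPow η H k) := by
    rw [toForm_cliffPow, involute_divPow hH]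
  refine (toForm_anticomm_of_even η v h).trans ?_
  rw [toForm_cliffPow]

theorem toForm_C (k : ℤ) (v ξ : Fin n → ℝ) :
    toForm η ((tower hη hH).C k v ξ) = (4 : ℝ) • (vec v * (vec ξ * divPow H (k - 1))) := by
  have h : CliffordAlgebra.involute (toForm η ((tower hη hH).W (k - 1) ξ))
      = -toForm η ((tower hη hH).W (k - 1) ξ) := by
    rw [toForm_W]
    exact (isOddForm_vec_mul ξ (involute_divPow hH _)).smul 2
  refine (toForm_comm_of_odd η v h).trans ?_
  rw [toForm_W, mul_smul_comm, smul_smul]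
  norm_num

theorem toForm_anticomm_C (k : ℤ) (a : Fin n) (v ξ : Fin n → ℝ) :
    toForm η (gam η (Pi.single a 1) * (tower hη hH).C k v ξ
        + (tower hη hH).C k v ξ * gam η (Pi.single a 1))
      = -((8 : ℝ) • (vec v * (coframe a * (vec ξ * divPow H (k - 1))))) := by
  have h : CliffordAlgebra.involute (toForm η ((tower hη hH).C k v ξ))
      = toForm η ((tower hη hH).C k v ξ) := by
    rw [toForm_C, map_smul, map_mul, isOddForm_vec_mul ξ (involute_divPow hH _),
      CliffordAlgebra.involute_ι, neg_mul_neg]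
  rw [toForm_anticomm_of_even η _ h, toForm_C, mul_smul_comm, vec_mul_vec_mul, smul_smul, smul_neg]
  norm_num
  rfl

theorem wedgeUp_pow_eq (k : ℕ) (a : Fin n) : wedgeUp a (H ^ k)
    = ((k.factorial : ℝ) / 2) • toForm η ((tower hη hH).W k (Pi.single a 1)) := by
  rw [toForm_W, smul_smul, div_mul_cancel₀ _ two_ne_zero, pow_eq_divPow, map_smul]
  rfl

end Tower

/-! ### Commutators and first-order coefficients of the towers -/

section Geometry

variable {M : Type*} [TopologicalSpace M] [ChartedSpace (EuclideanSpace ℝ (Fin n)) M]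
  [IsManifold (𝓡 n) ∞ M] {g : PseudoRiemannianMetric n M} {U : Set M}
  (F : OrthonormalFrame g U) (h : TwoForm n M)

/-- Up to a factor this is `CliffordTower.Om_symmetrized` for two covectors of the frame. -/
theorem comm_wedgeDown_towerH_symmetrized (k l : ℕ) (x : M) (a b : Fin n) :
    comm F.η (wedgeDown F.η a (F.towerH h k x)) (wedgeDown F.η b (F.towerH h l x))
      + comm F.η (wedgeDown F.η b (F.towerH h k x)) (wedgeDown F.η a (F.towerH h l x)) = 0 := by
  have hH := ofTwoForm_mem F h x
  have h1 := (tower F.η_eq hH).Om_symmetrized k l (Pi.single a 1) (Pi.single b 1)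
  simp only [wedgeDown, LinearMap.smul_apply, OrthonormalFrame.towerH,
    wedgeUp_pow_eq F.η_eq hH, smul_smul, comm_smul_toForm]
  rw [mul_mul_mul_comm (F.η a), mul_mul_mul_comm (F.η b), mul_comm (F.η b), ← smul_add, ← map_add]
  refine (congrArg (fun y => _ • toForm F.η y) h1).trans ?_
  simp only [map_zero, smul_zero]

theorem involute_towerH (k : ℕ) (x : M) :
    CliffordAlgebra.involute (F.towerH h k x) = F.towerH h k x := by
  rw [OrthonormalFrame.towerH, map_pow, involute_of_mem (ofTwoForm_mem F h x)]
  simp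

theorem isOddForm_wedgeUp_towerH (k : ℕ) (x : M) (a : Fin n) :
    IsOddForm (wedgeUp a (F.towerH h k x)) :=
  isOddForm_vec_mul _ (involute_towerH F h k x)

theorem isOddForm_wedgeDown_towerH (k : ℕ) (x : M) (a : Fin n) :
    IsOddForm (wedgeDown F.η a (F.towerH h k x)) :=
  (isOddForm_wedgeUp_towerH F h k x a).smul _

theorem hookDown_towerF (k : ℕ) (x : M) (a : Fin n) : hookDown a (F.towerF h k x)
    = (-1 : ℝ) ^ k • volMul F.η (wedgeDown F.η a (F.towerH h k x)) := by
  rw [towerF_apply, map_smul, hookDown_volMul F.η_eq]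

theorem hookUp_towerF (k : ℕ) (x : M) (a : Fin n) : hookUp F.η a (F.towerF h k x)
    = (-1 : ℝ) ^ k • volMul F.η (wedgeUp a (F.towerH h k x)) := by
  rw [towerF_apply, map_smul, hookUp_volMul]

theorem comm_hookDown_towerF_symmetrized (k l : ℕ) (x : M) (a b : Fin n) :
    comm F.η (hookDown a (F.towerF h k x)) (hookDown b (F.towerF h l x))
      + comm F.η (hookDown b (F.towerF h k x)) (hookDown a (F.towerF h l x)) = 0 := by
  simp only [hookDown_towerF, comm_smul_smul]
  rw [comm_volMul_volMul _ (isOddForm_wedgeDown_towerH F h k x a)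
    (isOddForm_wedgeDown_towerH F h l x b), comm_volMul_volMul _
    (isOddForm_wedgeDown_towerH F h k x b) (isOddForm_wedgeDown_towerH F h l x a), ← smul_add,
    ← neg_add, ← smul_add, ← map_add, ← map_add, comm_wedgeDown_towerH_symmetrized]
  simp only [map_zero, smul_zero, neg_zero]

theorem comm_hookDown_towerF_wedgeDown_towerH_symmetrized (hn : Odd n) (k l : ℕ) (x : M)
    (a b : Fin n) :
    comm F.η (hookDown a (F.towerF h k x)) (wedgeDown F.η b (F.towerH h l x))
      + comm F.η (hookDown b (F.towerF h k x)) (wedgeDown F.η a (F.towerH h l x)) = 0 := by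
  simp only [hookDown_towerF, ← map_smul (volMul F.η), comm_volMul_left hn]
  rw [← map_add]
  have h1 (a b : Fin n) : comm F.η ((-1 : ℝ) ^ k • wedgeDown F.η a (F.towerH h k x))
      (wedgeDown F.η b (F.towerH h l x)) = (-1 : ℝ) ^ k •
        comm F.η (wedgeDown F.η a (F.towerH h k x)) (wedgeDown F.η b (F.towerH h l x)) := by
    simpa using comm_smul_smul F.η ((-1) ^ k) 1 (wedgeDown F.η a (F.towerH h k x))
      (wedgeDown F.η b (F.towerH h l x))
  rw [h1, h1, ← smul_add, comm_wedgeDown_towerH_symmetrized, smul_zero, map_zero]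

variable {F h} {x : M} {ξ : Fin n → ℝ}

theorem wedgeUp_nabla_towerH (hx : x ∈ U)
    (hξ : ∀ a, F.nabla a (F.ofTwoForm h) x = wedgeDown F.η a (vec ξ)) (k : ℕ) (a b : Fin n) :
    wedgeUp b (F.nabla a (F.towerH h k) x) = -(k.factorial / 8 * F.η a : ℝ) •
      toForm F.η (gam F.η (Pi.single a 1) *
          (tower F.η_eq (ofTwoForm_mem F h x)).C k (Pi.single b 1) ξ
        + (tower F.η_eq (ofTwoForm_mem F h x)).C k (Pi.single b 1) ξ *
          gam F.η (Pi.single a 1)) := by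
  rw [toForm_anticomm_C, nabla_towerH hx hξ, smul_neg, neg_smul, neg_neg, smul_smul]
  simp only [wedgeDown, wedgeUp, LinearMap.smul_apply, LinearMap.mulLeft_apply, mul_smul_comm,
    smul_smul]
  congr 1
  ring

theorem zeroM_towerH_eq (hx : x ∈ U)
    (hξ : ∀ a, F.nabla a (F.ofTwoForm h) x = wedgeDown F.η a (vec ξ)) {k : ℕ} (hk : 2 * k ≤ n) :
    F.zeroM (F.towerH h k) x = ((n - 2 * k : ℝ) * k.factorial / 4) •
      toForm F.η ((tower F.η_eq (ofTwoForm_mem F h x)).W (k - 1) ξ) := by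
  rw [zeroM_towerH hx hξ hk, toForm_W, smul_smul, smul_smul]
  congr 1
  ring

theorem coeffMM_towerH_eq_zero_of_le (hx : x ∈ U)
    (hξ : ∀ a, F.nabla a (F.ofTwoForm h) x = wedgeDown F.η a (vec ξ)) {k l : ℕ} (hk : 2 * k ≤ n)
    (hl : 2 * l ≤ n) (b : Fin n) : F.coeffMM (F.towerH h k) (F.towerH h l) b x = 0 := by
  have hH := ofTwoForm_mem F h x
  have h1 := congrArg (toForm F.η)
    ((tower F.η_eq hH).sum_W_mul_ι_C_sub k l (Pi.single b 1) ξ)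
  simp only [map_sub, map_sum, map_smul] at h1
  rw [OrthonormalFrame.coeffMM, OrthonormalFrame.commCoeff]
  simp only [wedgeUp_nabla_towerH hx hξ, zeroM_towerH_eq hx hξ hk, zeroM_towerH_eq hx hξ hl]
  simp only [OrthonormalFrame.towerH, wedgeUp_pow_eq F.η_eq hH, cmul_smul_toForm,
    comm_smul_toForm, Finset.sum_sub_distrib]
  -- The frame sums of the coefficient are `k! l! / 16` times those of the tower identity.
  have h2 (k l : ℕ) : ∑ a, ((k.factorial : ℝ) / 2 * -(l.factorial / 8 * F.η a)) •
        toForm F.η ((tower F.η_eq hH).W k (Pi.single a 1) * (gam F.η (Pi.single a 1) *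
          (tower F.η_eq hH).C l (Pi.single b 1) ξ + (tower F.η_eq hH).C l (Pi.single b 1) ξ *
          gam F.η (Pi.single a 1)))
      = -((k.factorial * l.factorial / 16 : ℝ) • ∑ a, F.η a •
        toForm F.η ((tower F.η_eq hH).W k (Pi.single a 1) * (gam F.η (Pi.single a 1) *
          (tower F.η_eq hH).C l (Pi.single b 1) ξ + (tower F.η_eq hH).C l (Pi.single b 1) ξ *
          gam F.η (Pi.single a 1)))) := by
    rw [Finset.smul_sum, ← Finset.sum_neg_distrib]
    refine Finset.sum_congr rfl fun a _ => ?_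
    rw [smul_smul, ← neg_smul]
    congr 1
    ring
  rw [h2, h2]
  -- The fields of `tower` are unfolded, so that both sides contain the same sums.
  change ∑ a, F.η a • toForm F.η ((tower F.η_eq hH).W k (Pi.single a 1) *
      (gam F.η (Pi.single a 1) * (tower F.η_eq hH).C l (Pi.single b 1) ξ
        + (tower F.η_eq hH).C l (Pi.single b 1) ξ * gam F.η (Pi.single a 1)))
    - ∑ a, F.η a • toForm F.η ((tower F.η_eq hH).W l (Pi.single a 1) *
      (gam F.η (Pi.single a 1) * (tower F.η_eq hH).C k (Pi.single b 1) ξ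
        + (tower F.η_eq hH).C k (Pi.single b 1) ξ * gam F.η (Pi.single a 1)))
    = (2 * (n - 2 * (l : ℤ)) : ℝ) • toForm F.η ((tower F.η_eq hH).W k (Pi.single b 1) *
        (tower F.η_eq hH).W (l - 1) ξ - (tower F.η_eq hH).W (l - 1) ξ *
        (tower F.η_eq hH).W k (Pi.single b 1))
      - (2 * (n - 2 * (k : ℤ)) : ℝ) • toForm F.η ((tower F.η_eq hH).W l (Pi.single b 1) *
        (tower F.η_eq hH).W (k - 1) ξ - (tower F.η_eq hH).W (k - 1) ξ *
        (tower F.η_eq hH).W l (Pi.single b 1)) at h1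
  generalize toForm F.η ((tower F.η_eq hH).W k (Pi.single b 1) *
        (tower F.η_eq hH).W (l - 1) ξ - (tower F.η_eq hH).W (l - 1) ξ *
        (tower F.η_eq hH).W k (Pi.single b 1)) = P at *
  generalize toForm F.η ((tower F.η_eq hH).W l (Pi.single b 1) *
        (tower F.η_eq hH).W (k - 1) ξ - (tower F.η_eq hH).W (k - 1) ξ *
        (tower F.η_eq hH).W l (Pi.single b 1)) = Q at *
  rw [sub_eq_iff_eq_add] at h1
  rw [h1]
  push_cast
  module

theorem commCoeff_zero_left (P Q : Fin n → Form n →ₗ[ℝ] Form n) {α' β β' : M → Form n}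
    (hα' : α' x = 0) (b : Fin n) : F.commCoeff P (fun _ => 0) α' Q β β' b x = 0 := by
  simp [OrthonormalFrame.commCoeff, nabla_zero, hα', cmul_zero_left, cmul_zero_right,
    comm_zero_left, comm_zero_right]

theorem commCoeff_zero_right (P Q : Fin n → Form n →ₗ[ℝ] Form n) {α α' β' : M → Form n}
    (hβ' : β' x = 0) (b : Fin n) : F.commCoeff P α α' Q (fun _ => 0) β' b x = 0 := by
  simp [OrthonormalFrame.commCoeff, nabla_zero, hβ', cmul_zero_left, cmul_zero_right,
    comm_zero_left, comm_zero_right]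

theorem zeroM_zero : F.zeroM (fun _ => 0) x = 0 := by
  simp [OrthonormalFrame.zeroM, OrthonormalFrame.codiff, nabla_zero]

theorem zeroK_zero : F.zeroK (fun _ => 0) x = 0 := by
  simp [OrthonormalFrame.zeroK, OrthonormalFrame.extd, nabla_zero]

theorem towerF_eq_zero {k : ℕ} (hk : n < 2 * k) : F.towerF h k = fun _ => 0 := by
  simp only [towerF_eq, towerH_eq_zero F h hk, map_zero]

variable (F)

/-- If `2k > n` or `2l > n`, one of the towers vanishes identically. -/
theorem coeffMM_towerH (hh : h.IsCCKY g) (hx : x ∈ U) (k l : ℕ) (b : Fin n) :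
    F.coeffMM (F.towerH h k) (F.towerH h l) b x = 0 := by
  obtain ⟨ξ, hξ⟩ := exists_nabla_eq_of_isCCKY F hh hx
  rcases lt_or_ge n (2 * k) with hk | hk
  · rw [OrthonormalFrame.coeffMM, towerH_eq_zero F h hk]
    exact commCoeff_zero_left _ _ zeroM_zero b
  rcases lt_or_ge n (2 * l) with hl | hl
  · rw [OrthonormalFrame.coeffMM, towerH_eq_zero F h hl]
    exact commCoeff_zero_right _ _ zeroM_zero b
  exact coeffMM_towerH_eq_zero_of_le hx hξ hk hl b

theorem hookUp_nabla_towerF (hx : x ∈ U) (k : ℕ) (a b : Fin n) :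
    hookUp F.η b (F.nabla a (F.towerF h k) x)
      = (-1 : ℝ) ^ k • volMul F.η (wedgeUp b (F.nabla a (F.towerH h k) x)) := by
  rw [nabla_towerF hx, map_smul, hookUp_volMul]

/-- Each of the Clifford products is that of `coeffMM` for the towers `h^(k)` and `h^(l)`, with
both factors multiplied by the volume form. -/
theorem coeffKK_towerF (hh : h.IsCCKY g) (hx : x ∈ U) (k l : ℕ) (b : Fin n) :
    F.coeffKK (F.towerF h k) (F.towerF h l) b x = 0 := by
  obtain ⟨ξ, hξ⟩ := exists_nabla_eq_of_isCCKY F hh hx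
  rcases lt_or_ge n (2 * k) with hk | hk
  · rw [OrthonormalFrame.coeffKK, towerF_eq_zero hk]
    exact commCoeff_zero_left _ _ zeroK_zero b
  rcases lt_or_ge n (2 * l) with hl | hl
  · rw [OrthonormalFrame.coeffKK, towerF_eq_zero hl]
    exact commCoeff_zero_right _ _ zeroK_zero b
  have hn (k : ℕ) (a b : Fin n) : IsOddForm (wedgeUp b (F.nabla a (F.towerH h k) x)) := by
    rw [nabla_towerH hx hξ]
    refine isOddForm_vec_mul _ ?_
    rw [wedgeDown, LinearMap.smul_apply, map_smul, map_smul, map_smul, wedgeUp,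
      LinearMap.mulLeft_apply, map_mul,
      isOddForm_vec_mul ξ (involute_divPow (ofTwoForm_mem F h x) _),
      coframe, CliffordAlgebra.involute_ι, neg_mul_neg]
  have hz {k : ℕ} (hk : 2 * k ≤ n) : IsOddForm (F.zeroM (F.towerH h k) x) := by
    rw [zeroM_towerH hx hξ hk]
    exact ((isOddForm_vec_mul ξ (involute_divPow (ofTwoForm_mem F h x) _)).smul _).smul _
  have h0 := coeffMM_towerH F hh hx k l b
  rw [OrthonormalFrame.coeffMM, OrthonormalFrame.commCoeff] at h0
  rw [OrthonormalFrame.coeffKK, OrthonormalFrame.commCoeff]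
  have h1 := congrArg (fun φ => -((-1 : ℝ) ^ k * (-1) ^ l * (-1) ^ n) •
    volMul F.η (volMul F.η φ)) h0
  simp only [map_zero, smul_zero, map_add, map_sub, map_sum, smul_add, smul_sub,
    Finset.smul_sum] at h1
  rw [← h1]
  simp only [hookUp_towerF, hookUp_nabla_towerF F hx, zeroK_towerF hx hξ hk, zeroK_towerF hx hξ hl,
    cmul_smul_smul, comm_smul_smul, cmul_volMul_volMul _ _ (hn _ _ _),
    comm_volMul_volMul _ (isOddForm_wedgeUp_towerH F h _ x _) (hz hk),
    comm_volMul_volMul _ (isOddForm_wedgeUp_towerH F h _ x _) (hz hl)]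
  simp only [mul_comm ((-1 : ℝ) ^ l) ((-1 : ℝ) ^ k), smul_neg, smul_smul, neg_smul]

/-- Each of the Clifford products is that of `coeffMM` for the towers `h^(k)` and `h^(l)`,
multiplied by the central volume form. -/
theorem coeffKM_towerF_towerH (hn : Odd n) (hh : h.IsCCKY g) (hx : x ∈ U) (k l : ℕ) (b : Fin n) :
    F.coeffKM (F.towerF h k) (F.towerH h l) b x = 0 := by
  obtain ⟨ξ, hξ⟩ := exists_nabla_eq_of_isCCKY F hh hx
  rcases lt_or_ge n (2 * k) with hk | hk
  · rw [OrthonormalFrame.coeffKM, towerF_eq_zero hk]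
    exact commCoeff_zero_left _ _ zeroK_zero b
  have h0 := coeffMM_towerH F hh hx k l b
  rw [OrthonormalFrame.coeffMM, OrthonormalFrame.commCoeff] at h0
  rw [OrthonormalFrame.coeffKM, OrthonormalFrame.commCoeff]
  have h1 := congrArg (fun φ => (-1 : ℝ) ^ k • volMul F.η φ) h0
  simp only [map_zero, smul_zero, map_add, map_sub, map_sum, smul_add, smul_sub,
    Finset.smul_sum] at h1
  have hl (α β : Form n) : cmul F.η ((-1 : ℝ) ^ k • α) β = (-1 : ℝ) ^ k • cmul F.η α β := by
    simpa using cmul_smul_smul F.η ((-1) ^ k) 1 α β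
  have hr (α β : Form n) : cmul F.η α ((-1 : ℝ) ^ k • β) = (-1 : ℝ) ^ k • cmul F.η α β := by
    simpa using cmul_smul_smul F.η 1 ((-1) ^ k) α β
  rw [← h1]
  simp only [comm, hookUp_towerF, hookUp_nabla_towerF F hx, zeroK_towerF hx hξ hk, hl, hr,
    cmul_volMul_left hn, cmul_volMul_right, map_sub, smul_sub]

end Geometry

end KillingYano

end

theorem mainTheorem4 (n : ℕ) (M : Type*) [TopologicalSpace M]
    [ChartedSpace (EuclideanSpace ℝ (Fin n)) M] [IsManifold (𝓡 n) ∞ M]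
    (g : KillingYano.PseudoRiemannianMetric n M) (h : KillingYano.TwoForm n M)
    (hh : h.IsCCKY g) (U : Set M) (F : KillingYano.OrthonormalFrame g U) (k l : ℕ) :
    -- the tower `h^(k)`
    ((∀ x ∈ U, ∀ a b,
        KillingYano.comm F.η (KillingYano.wedgeDown F.η a (F.towerH h k x))
            (KillingYano.wedgeDown F.η b (F.towerH h l x))
          + KillingYano.comm F.η (KillingYano.wedgeDown F.η b (F.towerH h k x))
            (KillingYano.wedgeDown F.η a (F.towerH h l x)) = 0) ∧
      (∀ x ∈ U, ∀ b, F.coeffMM (F.towerH h k) (F.towerH h l) b x = 0) ∧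
      (∀ x ∈ U, F.bracketMM (F.towerH h k) (F.towerH h l) x = 0)) ∧
    -- the dual tower `f^(k)`
    ((∀ x ∈ U, ∀ a b,
        KillingYano.comm F.η (KillingYano.hookDown a (F.towerF h k x))
            (KillingYano.hookDown b (F.towerF h l x))
          + KillingYano.comm F.η (KillingYano.hookDown b (F.towerF h k x))
            (KillingYano.hookDown a (F.towerF h l x)) = 0) ∧
      (∀ x ∈ U, ∀ b, F.coeffKK (F.towerF h k) (F.towerF h l) b x = 0) ∧
      (∀ x ∈ U, F.bracketKK (F.towerF h k) (F.towerF h l) x = 0)) ∧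
    -- the mixed pairs, in odd dimension
    (Odd n →
      (∀ x ∈ U, ∀ a b,
        KillingYano.comm F.η (KillingYano.hookDown a (F.towerF h k x))
            (KillingYano.wedgeDown F.η b (F.towerH h l x))
          + KillingYano.comm F.η (KillingYano.hookDown b (F.towerF h k x))
            (KillingYano.wedgeDown F.η a (F.towerH h l x)) = 0) ∧
      (∀ x ∈ U, ∀ b, F.coeffKM (F.towerF h k) (F.towerH h l) b x = 0) ∧
      (∀ x ∈ U, F.bracketKM (F.towerF h k) (F.towerH h l) x = 0)) := by
  refine ⟨⟨fun x _ a b => KillingYano.comm_wedgeDown_towerH_symmetrized F h k l x a b,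
    fun x hx b => KillingYano.coeffMM_towerH F hh hx k l b, fun x hx => ?_⟩,
    ⟨fun x _ a b => KillingYano.comm_hookDown_towerF_symmetrized F h k l x a b,
      fun x hx b => KillingYano.coeffKK_towerF F hh hx k l b, fun x hx => ?_⟩,
    fun hn => ⟨fun x _ a b =>
      KillingYano.comm_hookDown_towerF_wedgeDown_towerH_symmetrized F h hn k l x a b,
      fun x hx b => KillingYano.coeffKM_towerF_towerH F hn hh hx k l b, fun x hx => ?_⟩⟩
  · simp only [KillingYano.OrthonormalFrame.bracketMM, KillingYano.coeffMM_towerH F hh hx,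
      map_zero, Finset.sum_const_zero]
  · simp only [KillingYano.OrthonormalFrame.bracketKK, KillingYano.coeffKK_towerF F hh hx,
      map_zero, Finset.sum_const_zero]
  · simp only [KillingYano.OrthonormalFrame.bracketKM,
      KillingYano.coeffKM_towerF_towerH F hn hh hx, map_zero, Finset.sum_const_zero]
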